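/- All graphs are finite, simple and undirected. A graph is weakly semiregular if there are two numbers $a,b$ (not necessarily distinct) such that the degree of every vertex is $a$ or $b$. The weakly semiregular number $wr(G)$ of a graph $G$ is the minimum number of subsets into which the edge set of $G$ can be partitioned so that, for each subset, the subgraph induced by it (its edges together with their end points) is weakly semiregular. Algorithms are programs for a word RAM with words of $O(\log n)$ bits, whose unit-time instructions are assignment of constants, copying, addition, truncated subtraction, comparison-based branching and indirect memory access. The input is a tree with vertices $0,\dots,n-1$, given by $n$ and a list of its edges in any order. **Theorem.** (i) There is an $O(n^2)$ time algorithm that determines whether the weakly semiregular number of a given tree is two, where $n$ is the number of vertices of the tree. (ii) For every constant $c\in\mathbb{N}$ there is a polynomial time algorithm (polynomial in the number $n$ of vertices) that determines whether the weakly semiregular number of a given tree is at most $c$. (iii) There is an absolute constant $C$ such that $wr(T)\le 2\log_2\Delta(T)+C$ for every tree $T$, where $\Delta(T)$ is the maximum degree of $T$ (and $\log_2 0$ is read as $0$ for the one-vertex tree). -/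

import Mathlib

/-! ## Weakly semiregular graphs -/

namespace SimpleGraph

/-- A (finite) graph is weakly semiregular if there are two numbers `a`, `b`, not necessarily
distinct, such that the degree of every vertex is `a` or `b`. -/
def IsWeaklySemiregular {V : Type*} (G : SimpleGraph V) : Prop :=
  ∃ a b : ℕ, ∀ v : V, (G.neighborSet v).ncard = a ∨ (G.neighborSet v).ncard = b

/-- The subgraph of `G` induced by a set `s` of edges of `G`: its edges are the members of `s` and
its vertices are the end points of these edges. -/
def edgeInduced {V : Type*} (G : SimpleGraph V) (s : Set (Sym2 V)) : G.Subgraph where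
  verts := {v | ∃ w, G.Adj v w ∧ s(v, w) ∈ s}
  Adj v w := G.Adj v w ∧ s(v, w) ∈ s
  adj_sub h := h.1
  edge_vert {_ w} h := ⟨w, h⟩
  symm := ⟨fun v w h => ⟨h.1.symm, Sym2.eq_swap (a := v) (b := w) ▸ h.2⟩⟩

/-- The edge set of `G` can be partitioned into exactly `k` (nonempty, pairwise disjoint) subsets
such that the subgraph induced by each subset is weakly semiregular. -/
def HasWeaklySemiregularPartition {V : Type*} (G : SimpleGraph V) (k : ℕ) : Prop :=
  ∃ P : Finpartition G.edgeSet, P.parts.card = k ∧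
    ∀ s ∈ P.parts, (G.edgeInduced s).coe.IsWeaklySemiregular

/-- The weakly semiregular number `wr(G)` of a finite graph `G`: the minimum number of subsets into
which the edge set of `G` can be partitioned so that the subgraph induced by each subset is weakly
semiregular. (For a finite graph such a partition exists, by
`exists_hasWeaklySemiregularPartition`.) -/
noncomputable def wr {V : Type*} (G : SimpleGraph V) : ℕ :=
  sInf {k | G.HasWeaklySemiregularPartition k}

/-- Every finite graph has a partition as in the definition of `wr`: take single edges. -/
theorem exists_hasWeaklySemiregularPartition {V : Type*} [Finite V] (G : SimpleGraph V) :
    ∃ k, G.HasWeaklySemiregularPartition k := by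
  classical
  have hf : G.edgeSet.Finite := Set.toFinite _
  let F : Finset (Set (Sym2 V)) := hf.toFinset.image fun e => {e}
  have hF : ∀ s, s ∈ F ↔ ∃ e ∈ G.edgeSet, {e} = s := fun s => by simp [F]
  refine ⟨F.card, ⟨F, ?_, ?_, ?_⟩, rfl, ?_⟩
  · rw [Finset.supIndep_iff_pairwiseDisjoint]
    intro s hs t ht hst
    obtain ⟨e, -, rfl⟩ := (hF s).1 hs
    obtain ⟨f, -, rfl⟩ := (hF t).1 ht
    simpa [Function.onFun, eq_comm] using hst
  · ext e
    simp [F, Finset.sup_image]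
  · simp [F]
  · intro s hs
    obtain ⟨e, -, rfl⟩ := (hF s).1 hs
    refine ⟨1, 1, fun v => Or.inl ?_⟩
    obtain ⟨v, w, hvw, hv⟩ := v
    have hwv : G.Adj w v ∧ s(w, v) ∈ ({e} : Set (Sym2 V)) :=
      ⟨hvw.symm, Sym2.eq_swap (a := v) (b := w) ▸ hv⟩
    rw [Set.ncard_eq_one]
    refine ⟨⟨w, v, hwv⟩, ?_⟩
    ext ⟨x, hx⟩
    constructor
    · intro h
      have h' : s(v, x) = s(v, w) :=
        (Set.mem_singleton_iff.1 h.2).trans (Set.mem_singleton_iff.1 hv).symm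
      exact Set.mem_singleton_iff.2 (Subtype.ext (Sym2.congr_right.1 h'))
    · intro h
      obtain rfl : x = w := congrArg Subtype.val (Set.mem_singleton_iff.1 h)
      exact ⟨hvw, hv⟩

end SimpleGraph

/-! ## Random-access machines

A word RAM with finitely many registers and finitely many arrays (a program mentions only finitely
many). Registers and array cells hold natural numbers up to a word bound `W`; a computation that
would write a larger number has no result. Every instruction and every evaluation of a branching
condition takes one unit of time. Programs are built from instructions by sequencing, branching and
loops. -/

namespace RAM

/-- The memory of the machine: `reg x` is the content of register `x`, and `arr a i` is the `i`-th
cell of array `a`. -/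
@[ext] structure State where
  reg : ℕ → ℕ
  arr : ℕ → ℕ → ℕ

/-- The instructions of the machine; `x`, `y`, `z`, `i` are register names and `a` an array name. -/
inductive Instr : Type
  /-- `R[x] := k` -/
  | const (x k : ℕ)
  /-- `R[x] := R[y]` -/
  | copy (x y : ℕ)
  /-- `R[x] := R[y] + R[z]` -/
  | add (x y z : ℕ)
  /-- `R[x] := R[y] - R[z]`, truncated at zero -/
  | sub (x y z : ℕ)
  /-- `R[x] := A[a][R[i]]` -/
  | load (x a i : ℕ)
  /-- `A[a][R[i]] := R[x]` -/
  | store (a i x : ℕ)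

/-- The number that an instruction writes. -/
def Instr.value : Instr → State → ℕ
  | const _ k, _ => k
  | copy _ y, s => s.reg y
  | add _ y z, s => s.reg y + s.reg z
  | sub _ y z, s => s.reg y - s.reg z
  | load _ a i, s => s.arr a (s.reg i)
  | store _ _ x, s => s.reg x

/-- Write `v` to register `x`. -/
def State.setReg (s : State) (x v : ℕ) : State :=
  { s with reg := Function.update s.reg x v }

/-- Write `v` to cell `i` of array `a`. -/
def State.setArr (s : State) (a i v : ℕ) : State :=
  { s with arr := Function.update s.arr a (Function.update (s.arr a) i v) }

/-- The effect of an instruction. -/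
def Instr.exec (c : Instr) (s : State) : State :=
  match c with
  | const x _ | copy x _ | add x _ _ | sub x _ _ | load x _ _ => s.setReg x (c.value s)
  | store a i _ => s.setArr a (s.reg i) (c.value s)

/-- Branching conditions: comparisons of the contents of two registers. -/
inductive Test : Type
  | lt (x y : ℕ)
  | le (x y : ℕ)
  | eq (x y : ℕ)
  | ne (x y : ℕ)

/-- A branching condition holds in a state. -/
def Test.Holds : Test → State → Prop
  | lt x y, s => s.reg x < s.reg y
  | le x y, s => s.reg x ≤ s.reg y
  | eq x y, s => s.reg x = s.reg y
  | ne x y, s => s.reg x ≠ s.reg y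

/-- Programs: instructions combined by sequencing, branching (if `b` then `p` else `q`) and loops
(while `b` do `p`). -/
inductive Program : Type
  | skip : Program
  | instr (c : Instr) : Program
  | seq (p q : Program) : Program
  | ite (b : Test) (p q : Program) : Program
  | loop (b : Test) (p : Program) : Program

/-- `Exec W p s t s'`: on a machine with word bound `W`, the program `p` started in state `s` halts
after exactly `t` steps in state `s'`. -/
inductive Exec (W : ℕ) : Program → State → ℕ → State → Prop
  | skip (s : State) : Exec W .skip s 0 s
  | instr (c : Instr) (s : State) (h : c.value s ≤ W) : Exec W (.instr c) s 1 (c.exec s)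
  | seq {p q : Program} {s s₁ s₂ : State} {t₁ t₂ : ℕ}
      (hp : Exec W p s t₁ s₁) (hq : Exec W q s₁ t₂ s₂) : Exec W (.seq p q) s (t₁ + t₂) s₂
  | ite_true {b : Test} {p q : Program} {s s₁ : State} {t : ℕ}
      (hb : b.Holds s) (hp : Exec W p s t s₁) : Exec W (.ite b p q) s (t + 1) s₁
  | ite_false {b : Test} {p q : Program} {s s₁ : State} {t : ℕ}
      (hb : ¬ b.Holds s) (hq : Exec W q s t s₁) : Exec W (.ite b p q) s (t + 1) s₁
  | loop_true {b : Test} {p : Program} {s s₁ s₂ : State} {t₁ t₂ : ℕ}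
      (hb : b.Holds s) (hp : Exec W p s t₁ s₁) (hw : Exec W (.loop b p) s₁ t₂ s₂) :
      Exec W (.loop b p) s (t₁ + t₂ + 1) s₂
  | loop_false {b : Test} {p : Program} {s : State}
      (hb : ¬ b.Holds s) : Exec W (.loop b p) s 1 s

/-- The machine is deterministic: the halting time and the final state are unique. -/
theorem Exec.unique {W : ℕ} {p : Program} {s s₁ s₂ : State} {t₁ t₂ : ℕ}
    (h₁ : Exec W p s t₁ s₁) (h₂ : Exec W p s t₂ s₂) : t₁ = t₂ ∧ s₁ = s₂ := by
  induction h₁ generalizing t₂ s₂ with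
  | skip s => cases h₂; exact ⟨rfl, rfl⟩
  | instr c s h => cases h₂; exact ⟨rfl, rfl⟩
  | seq _ _ ihp ihq =>
    cases h₂ with
    | seq hp hq =>
      obtain ⟨rfl, rfl⟩ := ihp hp
      obtain ⟨rfl, rfl⟩ := ihq hq
      exact ⟨rfl, rfl⟩
  | ite_true hb _ ih =>
    cases h₂ with
    | ite_true _ hp => obtain ⟨rfl, rfl⟩ := ih hp; exact ⟨rfl, rfl⟩
    | ite_false hb' _ => exact absurd hb hb'
  | ite_false hb _ ih =>
    cases h₂ with
    | ite_true hb' _ => exact absurd hb' hb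
    | ite_false _ hq => obtain ⟨rfl, rfl⟩ := ih hq; exact ⟨rfl, rfl⟩
  | loop_true hb _ _ ihp ihw =>
    cases h₂ with
    | loop_true _ hp hw =>
      obtain ⟨rfl, rfl⟩ := ihp hp
      obtain ⟨rfl, rfl⟩ := ihw hw
      exact ⟨rfl, rfl⟩
    | loop_false hb' => exact absurd hb hb'
  | loop_false hb =>
    cases h₂ with
    | loop_true hb' _ _ => exact absurd hb' hb
    | loop_false _ => exact ⟨rfl, rfl⟩

/-- `l` lists every edge of `G` exactly once, each in one of its two orientations. -/
def IsEdgeList {n : ℕ} (G : SimpleGraph (Fin n)) (l : List (Fin n × Fin n)) : Prop :=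
  (l.map fun e => s(e.1, e.2)).Nodup ∧
    ∀ u v : Fin n, s(u, v) ∈ l.map (fun e => s(e.1, e.2)) ↔ G.Adj u v

/-- The initial state for a graph with vertices `0, …, n - 1` and edge list `l`: register `0` holds
`n`, arrays `0` and `1` hold the first and the second end points of the listed edges, and everything
else is zero. -/
def input (n : ℕ) (l : List (Fin n × Fin n)) : State where
  reg x := if x = 0 then n else 0
  arr a i :=
    match l[i]? with
    | none => 0
    | some e => if a = 0 then (e.1 : ℕ) else if a = 1 then (e.2 : ℕ) else 0

/-- There is an algorithm that decides, for every tree `T` with vertices `0, …, n - 1`, whether `T`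
has the property `P`, in time `O(n ^ k)`: a single program that, on every edge list of every such
`T`, halts within `C * n ^ k` steps, with a nonzero number in register `0` if and only if `P T`, and
that uses words of `O(log n)` bits only, that is, numbers at most `C * n ^ d` for constants `C`
and `d`. -/
def DecidableOnTreesInTime (P : ∀ n : ℕ, SimpleGraph (Fin n) → Prop) (k : ℕ) : Prop :=
  ∃ (p : Program) (C d : ℕ), ∀ (n : ℕ) (T : SimpleGraph (Fin n)), T.IsTree →
    ∀ l : List (Fin n × Fin n), IsEdgeList T l →
      ∃ (t : ℕ) (s : State), Exec (C * n ^ d) p (input n l) t s ∧ t ≤ C * n ^ k ∧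
        (s.reg 0 ≠ 0 ↔ P n T)

end RAM

/-!
A colour class of a tree is a forest, so if it is nonempty it has a vertex of degree `1`. Hence
`T.wr ≤ c`, for `c > 0`, means that the edges of `T` can be coloured with `c` colours so that, for
certain numbers `b i`, each vertex has `0`, `1` or `b i` edges of colour `i`
(`SimpleGraph.IsGrowth.wr_le_iff`). The tree is handled through a list of its vertices in which each
vertex other than the first one, the root, has its parent before it (`SimpleGraph.IsGrowth`); so it
is described by the function `par` that gives the position of the parent.

*The bound.* At a vertex of even depth, colour the edges to the children with one family of
colours, and at a vertex of odd depth with another, both with the numbers `b` equal to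
`1, 2, 4, …`. The binary expansion of the number of children tells how many edges of each colour to
use, and the edge to the parent, which belongs to the other family, contributes a degree `1`.

*Testing given degrees.* For given `b`, go through the vertices from the last one to the root, and
find for each vertex the list of the colours that the edge to its parent may have. A vertex with a
given colour of the parent edge is feasible if there are degrees `d i`, each `0`, `1` or `b i`, that
add up to its degree, such that the children can be given colours from their lists, with the
prescribed multiplicities. By Hall's theorem (`SimpleGraph.exists_assignment`) this
only depends on the numbers of children whose list is contained in `A`, for each set `A` of colours
(`SimpleGraph.CanExtend`, `SimpleGraph.IsColorTable.hasColoring_iff`). Because the number of colours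
is constant, a vertex takes constant time, and the test takes linear time
(`RAM.runs_colorProgram`).

*Searching for the degrees.* Values of `b i` above `n` are useless, so that running the test for all
`b` takes time `O(n ^ (c + 1))`. With two colours a quadratic algorithm results from the remark that
the maximum degree `D` of the tree is the sum of a degree in the first and one in the second colour:
unless the tree is a path, up to exchanging the colours the second number is `D`, `D - 1` or
`D - b 0`, so that a linear number of pairs is left (`SimpleGraph.HasColoring.exists_candidate`).
Finally, `T.wr = 2` means that `T.wr ≤ 2` and not `T.wr ≤ 1`.

The programs are verified with weakest preconditions `RAM.wp` for the loop-free parts, whose running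
time is bounded by their size, and invariants for the loops (`RAM.Runs.loop`). Registers with even
numbers hold values that survive a call of the linear time test, and those with odd numbers are used
for intermediate results.
-/

/-! ### Growing a tree one vertex at a time -/

namespace SimpleGraph

open Finset

variable {V : Type*} {T : SimpleGraph V} {e : ℕ → V} {par : ℕ → ℕ} {m n : ℕ}

/-- `e 0, …, e (m - 1)` are distinct vertices of `T`, and each `e k` with `0 < k < m` is adjacent to
its *parent* `e (par k)`, which occurs earlier in the list. Values of `e` and `par` beyond `m`, and
`par 0`, are irrelevant. -/
structure IsGrowth (T : SimpleGraph V) (m : ℕ) (e : ℕ → V) (par : ℕ → ℕ) : Prop where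
  inj : ∀ i < m, ∀ j < m, e i = e j → i = j
  lt : ∀ k, 0 < k → k < m → par k < k
  adj : ∀ k, 0 < k → k < m → T.Adj (e k) (e (par k))

namespace IsGrowth

theorem update [DecidableEq V] (h : T.IsGrowth m e par) {i : ℕ} {v : V} (hi : i < m)
    (hv : ∀ j < m, e j ≠ v) (hadj : T.Adj v (e i)) :
    T.IsGrowth (m + 1) (Function.update e m v) (Function.update par m i) := by
  have he : ∀ j < m, Function.update e m v j = e j := fun j hj =>
    Function.update_of_ne hj.ne _ _
  have hp : ∀ j < m, Function.update par m i j = par j := fun j hj =>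
    Function.update_of_ne hj.ne _ _
  refine ⟨fun a ha b hb hab => ?_, fun k hk hkm => ?_, fun k hk hkm => ?_⟩
  · rcases Nat.lt_succ_iff_lt_or_eq.1 ha with ha | rfl <;>
      rcases Nat.lt_succ_iff_lt_or_eq.1 hb with hb | rfl
    · rw [he a ha, he b hb] at hab
      exact h.inj a ha b hb hab
    · rw [he a ha, Function.update_self] at hab
      exact absurd hab (hv a ha)
    · rw [he b hb, Function.update_self] at hab
      exact absurd hab.symm (hv b hb)
    · rfl
  · rcases Nat.lt_succ_iff_lt_or_eq.1 hkm with hkm | rfl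
    · rw [hp k hkm]
      exact h.lt k hk hkm
    · simpa using hi
  · rcases Nat.lt_succ_iff_lt_or_eq.1 hkm with hkm | rfl
    · rw [hp k hkm, he k hkm, he _ ((h.lt k hk hkm).trans hkm)]
      exact h.adj k hk hkm
    · simpa [he i hi] using hadj

theorem le_card [Fintype V] (h : T.IsGrowth m e par) : m ≤ Fintype.card V := by
  have : Function.Injective fun i : Fin m => e i := fun i j hij =>
    Fin.ext (h.inj i i.2 j j.2 hij)
  simpa using Fintype.card_le_of_injective _ this

theorem surj [Fintype V] (h : T.IsGrowth m e par) (hm : m = Fintype.card V) (v : V) :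
    ∃ i < m, e i = v := by
  have : Function.Injective fun i : Fin m => e i := fun i j hij =>
    Fin.ext (h.inj i i.2 j j.2 hij)
  obtain ⟨i, hi⟩ :=
    ((Fintype.bijective_iff_injective_and_card _).2 ⟨this, by simpa using hm⟩).2 v
  exact ⟨i, i.2, hi⟩

/-- In a connected graph, a growth that misses a vertex is left by some edge. -/
theorem exists_crossing [Fintype V] (_h : T.IsGrowth m e par) (hT : T.Connected) (h0 : 0 < m)
    (hm : m < Fintype.card V) : ∃ i < m, ∃ v, (∀ j < m, e j ≠ v) ∧ T.Adj v (e i) := by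
  obtain ⟨v, hv⟩ : ∃ v, ∀ j < m, e j ≠ v := by
    by_contra! hcon
    choose f hf hfe using hcon
    have : Function.Injective fun v => (⟨f v, hf v⟩ : Fin m) := fun v w hvw => by
      rw [← hfe v, ← hfe w, Fin.mk.inj hvw]
    have := Fintype.card_le_of_injective _ this
    simp at this
    omega
  obtain ⟨d, -, ⟨i, hi, hid⟩, hd⟩ := (hT (e 0) v).some.exists_boundary_dart
    {w | ∃ i < m, e i = w} ⟨0, h0, rfl⟩ (by rintro ⟨i, hi, rfl⟩; exact hv i hi rfl)
  exact ⟨i, hi, d.snd, fun j hj hje => hd ⟨j, hj, hje⟩, hid ▸ d.adj.symm⟩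

end IsGrowth

theorem IsTree.exists_isGrowth [Fintype V] (hT : T.IsTree) :
    ∃ e par, T.IsGrowth (Fintype.card V) e par := by
  classical
  obtain ⟨r⟩ := hT.connected.nonempty
  have key : ∀ m, 0 < m → m ≤ Fintype.card V → ∃ e par, T.IsGrowth m e par := by
    intro m
    induction m with
    | zero => simp
    | succ m ih =>
      intro _ hm
      rcases Nat.eq_zero_or_pos m with rfl | h0
      · exact ⟨fun _ => r, fun _ => 0, by intros; omega, by intros; omega, by intros; omega⟩
      · obtain ⟨e, par, h⟩ := ih h0 (by omega)
        obtain ⟨i, hi, v, hv, hadj⟩ := h.exists_crossing hT.connected h0 (by omega)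
        exact ⟨_, _, h.update hi hv hadj⟩
  exact key _ (Fintype.card_pos_iff.2 ⟨r⟩) le_rfl

namespace IsGrowth

theorem edge_inj (h : T.IsGrowth n e par) {k l : ℕ} (hk : 0 < k) (hkn : k < n) (hl : 0 < l)
    (hln : l < n) (hkl : s(e k, e (par k)) = s(e l, e (par l))) : k = l := by
  have hk' := h.lt k hk hkn
  have hl' := h.lt l hl hln
  rcases Sym2.eq_iff.1 hkl with ⟨h1, -⟩ | ⟨h1, h2⟩
  · exact h.inj k hkn l hln h1
  · have h3 := h.inj k hkn _ (hl'.trans hln) h1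
    have h4 := h.inj _ (hk'.trans hkn) l hln h2
    omega

/-- A tree has no other edges than those from a vertex to its parent, because it has only `n - 1`
edges. -/
theorem exists_edge_eq [Fintype V] (h : T.IsGrowth n e par) (hT : T.IsTree)
    (hn : n = Fintype.card V) {x : Sym2 V} (hx : x ∈ T.edgeSet) :
    ∃ k, 0 < k ∧ k < n ∧ s(e k, e (par k)) = x := by
  classical
  have hsub : (Ico 1 n).image (fun k => s(e k, e (par k))) ⊆ T.edgeFinset := by
    intro y hy
    obtain ⟨k, hk, rfl⟩ := mem_image.1 hy
    rw [mem_Ico] at hk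
    simpa using h.adj k hk.1 hk.2
  have hcard : #((Ico 1 n).image (fun k => s(e k, e (par k)))) = n - 1 := by
    rw [card_image_of_injOn, Nat.card_Ico]
    intro k hk l hl hkl
    simp only [coe_Ico, Set.mem_Ico] at hk hl
    exact h.edge_inj hk.1 hk.2 hl.1 hl.2 hkl
  have heq := eq_of_subset_of_card_le hsub (by have := hT.card_edgeFinset; omega)
  have : x ∈ (Ico 1 n).image (fun k => s(e k, e (par k))) := by
    rw [heq]
    simpa using hx
  obtain ⟨k, hk, rfl⟩ := mem_image.1 this
  rw [mem_Ico] at hk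
  exact ⟨k, hk.1, hk.2, rfl⟩

/-- The degree of `e j` in the graph with edge set `s`: the edges to the children of `e j`, and the
edge to its parent. -/
theorem ncard_neighbors [Fintype V] (h : T.IsGrowth n e par) (hT : T.IsTree)
    (hn : n = Fintype.card V) (s : Set (Sym2 V)) [DecidablePred (· ∈ s)] {j : ℕ} (hj : j < n) :
    {w | T.Adj (e j) w ∧ s(e j, w) ∈ s}.ncard =
      #{k ∈ Ico 1 n | par k = j ∧ s(e k, e (par k)) ∈ s} +
        if 0 < j ∧ s(e j, e (par j)) ∈ s then 1 else 0 := by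
  classical
  have hset : {w | T.Adj (e j) w ∧ s(e j, w) ∈ s} =
      (({k ∈ Ico 1 n | par k = j ∧ s(e k, e (par k)) ∈ s} ∪
        if 0 < j ∧ s(e j, e (par j)) ∈ s then {par j} else ∅).image e : Finset V) := by
    ext w
    simp only [Set.mem_ofPred_eq, coe_image, Set.mem_image, mem_coe, mem_union, mem_filter, mem_Ico]
    constructor
    · rintro ⟨hadj, hs⟩
      obtain ⟨k, hk, hkn, hke⟩ := h.exists_edge_eq hT hn ((T.mem_edgeSet).2 hadj)
      rcases Sym2.eq_iff.1 hke with ⟨h1, h2⟩ | ⟨h1, h2⟩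
      · obtain rfl := h.inj k hkn j hj h1
        refine ⟨par k, Or.inr ?_, h2⟩
        rw [if_pos ⟨hk, by rwa [hke]⟩, mem_singleton]
      · have hp := h.inj _ ((h.lt k hk hkn).trans hkn) j hj h2
        exact ⟨k, Or.inl ⟨⟨hk, hkn⟩, hp, by rwa [hke]⟩, h1⟩
    · rintro ⟨k, ⟨⟨hk, hkn⟩, rfl, hs⟩ | hk, rfl⟩
      · exact ⟨(h.adj k hk hkn).symm, by rwa [Sym2.eq_swap]⟩
      · split_ifs at hk with hc
        · rw [mem_singleton] at hk
          subst hk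
          exact ⟨h.adj j hc.1 hj, hc.2⟩
        · simp at hk
  rw [hset, Set.ncard_coe_finset, card_image_of_injOn, card_union_of_disjoint]
  · split_ifs <;> simp
  · rw [Finset.disjoint_left]
    intro k hk hk'
    simp only [mem_filter, mem_Ico] at hk
    split_ifs at hk' with hc
    · rw [mem_singleton] at hk'
      have := h.lt k hk.1.1 hk.1.2
      have := h.lt j hc.1 hj
      omega
    · simp at hk'
  · intro k hk l hl hkl
    have aux : ∀ k ∈ ({k ∈ Ico 1 n | par k = j ∧ s(e k, e (par k)) ∈ s} ∪
        if 0 < j ∧ s(e j, e (par j)) ∈ s then {par j} else ∅), k < n := by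
      intro k hk
      simp only [mem_union, mem_filter, mem_Ico] at hk
      rcases hk with hk | hk
      · exact hk.1.2
      · split_ifs at hk with hc
        · rw [mem_singleton] at hk
          have := h.lt j hc.1 hj
          omega
        · simp at hk
    exact h.inj k (aux k hk) l (aux l hl) hkl

end IsGrowth

/-! ### Colourings of the edges of a tree -/

/-- In the tree on `0, …, n - 1` in which each `k > 0` is joined to `par k`, colour the edge from
`k` to `par k` with `col k`. This is the number of edges of colour `i` at the vertex `j`. -/
def colorDegree {α : Type*} [DecidableEq α] (n : ℕ) (par : ℕ → ℕ) (col : ℕ → α) (j : ℕ) (i : α) :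
    ℕ :=
  #{k ∈ Ico 1 n | par k = j ∧ col k = i} + if 0 < j ∧ col j = i then 1 else 0

/-- The tree given by `par` has an edge colouring in which the number of edges of colour `i` at a
vertex is `0`, `1` or `b i`. -/
def HasColoring {c : ℕ} (n : ℕ) (par : ℕ → ℕ) (b : Fin c → ℕ) : Prop :=
  ∃ col : ℕ → Fin c, ∀ j < n, ∀ i, colorDegree n par col j i = 0 ∨
    colorDegree n par col j i = 1 ∨ colorDegree n par col j i = b i

theorem ncard_neighborSet_edgeInduced (G : SimpleGraph V) (s : Set (Sym2 V))
    (v : (G.edgeInduced s).verts) :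
    ((G.edgeInduced s).coe.neighborSet v).ncard =
      {w | G.Adj (v : V) w ∧ s((v : V), w) ∈ s}.ncard := by
  rw [← Set.ncard_image_of_injective _ Subtype.val_injective]
  congr 1
  ext w
  constructor
  · rintro ⟨w, hw, rfl⟩
    exact hw
  · intro hw
    exact ⟨⟨w, v, hw.1.symm, by rw [Sym2.eq_swap]; exact hw.2⟩, hw, rfl⟩

/-- A colour class is a forest with an edge, so it has a vertex of degree `1`. Hence one of the two
degrees allowed in each class is `1`. -/
theorem IsGrowth.exists_degrees [Fintype V] (h : T.IsGrowth n e par) (hT : T.IsTree)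
    (hn : n = Fintype.card V) {s : Set (Sym2 V)} (hs : s ⊆ T.edgeSet) (hs0 : s.Nonempty)
    (hw : (T.edgeInduced s).coe.IsWeaklySemiregular) :
    ∃ b, ∀ j < n, ∀ d, {w | T.Adj (e j) w ∧ s(e j, w) ∈ s}.ncard = d → d = 0 ∨ d = 1 ∨ d = b := by
  classical
  obtain ⟨a, b, hab⟩ := hw
  have hdeg : ∀ j < n, ∀ d, {w | T.Adj (e j) w ∧ s(e j, w) ∈ s}.ncard = d →
      d = 0 ∨ d = a ∨ d = b := by
    rintro j hj d rfl
    by_cases hv : ∃ w, T.Adj (e j) w ∧ s(e j, w) ∈ s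
    · have := hab ⟨e j, hv⟩
      rw [ncard_neighborSet_edgeInduced] at this
      exact Or.inr this
    · left
      push Not at hv
      rw [Set.ncard_eq_zero]
      ext w
      simpa using hv w
  -- The last vertex whose edge to its parent lies in `s` has no other edge in `s`.
  let K := {k ∈ Ico 1 n | s(e k, e (par k)) ∈ s}
  have hK : K.Nonempty := by
    obtain ⟨x, hx⟩ := hs0
    obtain ⟨k, hk, hkn, rfl⟩ := h.exists_edge_eq hT hn (hs hx)
    exact ⟨k, by simp [K, hx]; omega⟩
  obtain ⟨k, hk, hmax⟩ : ∃ k ∈ K, ∀ l ∈ K, l ≤ k := ⟨K.max' hK, K.max'_mem hK, K.le_max'⟩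
  simp only [K, mem_filter, mem_Ico] at hk hmax
  have hone : {w | T.Adj (e k) w ∧ s(e k, w) ∈ s}.ncard = 1 := by
    rw [h.ncard_neighbors hT hn s hk.1.2, if_pos ⟨hk.1.1, hk.2⟩, Nat.add_eq_right, card_eq_zero,
      filter_eq_empty_iff]
    rintro l hl ⟨hlk, hls⟩
    rw [mem_Ico] at hl
    have := hmax l ⟨hl, hls⟩
    have := h.lt l hl.1 hl.2
    omega
  rcases hdeg k hk.1.2 1 hone with h1 | rfl | rfl
  · simp at h1
  · exact ⟨b, hdeg⟩
  · exact ⟨a, fun j hj d hd => by have := hdeg j hj d hd; tauto⟩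

theorem IsGrowth.wr_le_iff [Fintype V] (h : T.IsGrowth n e par) (hT : T.IsTree)
    (hn : n = Fintype.card V) {c : ℕ} (hc : 0 < c) :
    T.wr ≤ c ↔ ∃ b : Fin c → ℕ, HasColoring n par b := by
  classical
  constructor
  · intro hwr
    obtain ⟨P, hP, hPw⟩ : T.HasWeaklySemiregularPartition T.wr :=
      Nat.sInf_mem T.exists_hasWeaklySemiregularPartition
    have hcard : Fintype.card P.parts ≤ Fintype.card (Fin c) := by simpa [hP] using hwr
    obtain ⟨f⟩ := Function.Embedding.nonempty_of_card_le hcard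
    have hpart : ∀ x ∈ T.edgeSet, ∃ s : P.parts, x ∈ (s : Set (Sym2 V)) := by
      intro x hx
      rw [← P.sup_parts] at hx
      simpa using hx
    have huniq : ∀ (s t : P.parts) (x : Sym2 V), x ∈ (s : Set (Sym2 V)) →
        x ∈ (t : Set (Sym2 V)) → s = t := by
      intro s t x hxs hxt
      by_contra hst
      exact Set.disjoint_left.1
        (P.disjoint s.2 t.2 fun hst' => hst (Subtype.ext hst')) hxs hxt
    have hdeg : ∀ s : P.parts, ∃ b, ∀ j < n, ∀ d,
        {w | T.Adj (e j) w ∧ s(e j, w) ∈ (s : Set (Sym2 V))}.ncard = d →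
          d = 0 ∨ d = 1 ∨ d = b := fun s =>
      h.exists_degrees hT hn (P.le s.2) (Set.nonempty_iff_ne_empty.2 (P.ne_bot s.2)) (hPw s s.2)
    choose B hB using hdeg
    have hcol : ∀ k, ∃ i : Fin c, 0 < k → k < n →
        ∃ s : P.parts, f s = i ∧ s(e k, e (par k)) ∈ (s : Set (Sym2 V)) := by
      intro k
      by_cases hk : 0 < k ∧ k < n
      · obtain ⟨s, hs⟩ := hpart s(e k, e (par k)) (h.adj k hk.1 hk.2)
        exact ⟨f s, fun _ _ => ⟨s, rfl, hs⟩⟩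
      · exact ⟨⟨0, hc⟩, fun h1 h2 => absurd ⟨h1, h2⟩ hk⟩
    choose col hcol using hcol
    refine ⟨fun i => if hi : ∃ s, f s = i then B hi.choose else 0, col, fun j hj i => ?_⟩
    by_cases hi : ∃ s, f s = i
    · simp only [dif_pos hi]
      apply hB hi.choose j hj
      have hiff : ∀ k, 0 < k → k < n →
          (s(e k, e (par k)) ∈ (hi.choose : Set (Sym2 V)) ↔ col k = i) := by
        intro k hk hkn
        obtain ⟨s, hs, hks⟩ := hcol k hk hkn
        constructor
        · intro hk'
          rw [← hs, huniq s _ _ hks hk', hi.choose_spec]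
        · intro hki
          rwa [f.injective (hi.choose_spec.trans (hki.symm.trans hs.symm))]
      rw [h.ncard_neighbors hT hn _ hj, colorDegree]
      congr 2
      · refine filter_congr fun k hk => ?_
        rw [mem_Ico] at hk
        rw [hiff k hk.1 hk.2]
      · exact propext (and_congr_right fun h0 => hiff j h0 hj)
    · left
      have hne : ∀ k, 0 < k → k < n → col k ≠ i := fun k hk hkn hki => by
        obtain ⟨s, hs, -⟩ := hcol k hk hkn
        exact hi ⟨s, hs.trans hki⟩
      rw [colorDegree, if_neg fun h0 => hne j h0.1 hj h0.2, add_zero, card_eq_zero,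
        filter_eq_empty_iff]
      rintro k hk ⟨-, hki⟩
      rw [mem_Ico] at hk
      exact hne k hk.1 hk.2 hki
  · rintro ⟨b, col, hcol⟩
    let S : Fin c → Set (Sym2 V) := fun i =>
      {x | ∃ k, 0 < k ∧ k < n ∧ s(e k, e (par k)) = x ∧ col k = i}
    have hS : ∀ i k, 0 < k → k < n → (s(e k, e (par k)) ∈ S i ↔ col k = i) := by
      intro i k hk hkn
      constructor
      · rintro ⟨l, hl, hln, hlk, hli⟩
        rwa [← h.edge_inj hl hln hk hkn hlk]
      · exact fun hki => ⟨k, hk, hkn, rfl, hki⟩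
    have hind : (univ.image S).SupIndep id := by
      rw [supIndep_iff_pairwiseDisjoint]
      intro s hs t ht hst
      obtain ⟨i, -, rfl⟩ := mem_image.1 hs
      obtain ⟨j, -, rfl⟩ := mem_image.1 ht
      refine Set.disjoint_left.2 ?_
      rintro x ⟨k, hk, hkn, rfl, hki⟩ hx
      rw [id, hS j k hk hkn] at hx
      exact hst (by rw [← hki, hx])
    have hsup : (univ.image S).sup id = T.edgeSet := by
      ext x
      simp only [sup_image, Function.id_comp, sup_univ_eq_iSup, Set.iSup_eq_iUnion, Set.mem_iUnion]
      constructor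
      · rintro ⟨i, k, hk, hkn, rfl, -⟩
        exact h.adj k hk hkn
      · intro hx
        obtain ⟨k, hk, hkn, hkx⟩ := h.exists_edge_eq hT hn hx
        exact ⟨col k, k, hk, hkn, hkx, rfl⟩
    have hmem : (Finpartition.ofErase _ hind hsup).parts.card ∈
        {k | T.HasWeaklySemiregularPartition k} := by
      refine ⟨Finpartition.ofErase _ hind hsup, rfl, fun s hs => ?_⟩
      obtain ⟨i, -, rfl⟩ := mem_image.1 (mem_erase.1 hs).2
      refine ⟨1, b i, fun v => ?_⟩
      rw [ncard_neighborSet_edgeInduced]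
      obtain ⟨v, w, hvw⟩ := v
      obtain ⟨j, hj, rfl⟩ := h.surj hn v
      have hne : {w | T.Adj (e j) w ∧ s(e j, w) ∈ S i}.ncard ≠ 0 := by
        intro h0
        rw [Set.ncard_eq_zero] at h0
        exact Set.notMem_empty w (h0 ▸ hvw)
      have heq : {w | T.Adj (e j) w ∧ s(e j, w) ∈ S i}.ncard = colorDegree n par col j i := by
        rw [h.ncard_neighbors hT hn _ hj, colorDegree]
        congr 2
        · refine filter_congr fun k hk => ?_
          rw [mem_Ico] at hk
          rw [hS i k hk.1 hk.2]
        · exact propext (and_congr_right fun h0 => hS i j h0 hj)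
      rw [heq] at hne ⊢
      have := hcol j hj i
      tauto
    calc T.wr ≤ (Finpartition.ofErase _ hind hsup).parts.card := Nat.sInf_le hmem
      _ ≤ #(univ.image S) := card_le_card (erase_subset _ _)
      _ ≤ c := card_image_le.trans (by simp)

theorem wr_eq_zero_iff [Finite V] (G : SimpleGraph V) : G.wr = 0 ↔ G = ⊥ := by
  have hmem : G.HasWeaklySemiregularPartition G.wr :=
    Nat.sInf_mem G.exists_hasWeaklySemiregularPartition
  constructor
  · intro h0
    obtain ⟨P, hP, -⟩ := hmem
    rw [h0, card_eq_zero] at hP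
    rw [← edgeSet_eq_empty, ← P.sup_parts, hP]
    simp
  · rintro rfl
    obtain ⟨P, hP, -⟩ := hmem
    rw [← hP, card_eq_zero, P.parts_eq_empty_iff]
    simp

end SimpleGraph

namespace SimpleGraph

open Finset

variable {n : ℕ} {par : ℕ → ℕ}

/-- A function on the vertices of a rooted tree may be defined from the root downwards. -/
theorem exists_rec_parent {α : Type*} (hpar : ∀ k, 0 < k → k < n → par k < k) (x₀ : α)
    (Φ : ℕ → α → α) : ∃ x : ℕ → α, x 0 = x₀ ∧ ∀ k, 0 < k → k < n → x k = Φ k (x (par k)) := by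
  induction n with
  | zero => exact ⟨fun _ => x₀, rfl, by intros; omega⟩
  | succ n ih =>
    obtain ⟨x, hx0, hx⟩ := ih fun k hk hkn => hpar k hk (by omega)
    rcases Nat.eq_zero_or_pos n with rfl | hn
    · exact ⟨x, hx0, by intros; omega⟩
    · have hu : ∀ k < n, Function.update x n (Φ n (x (par n))) k = x k := fun k hk =>
        Function.update_of_ne hk.ne _ _
      refine ⟨Function.update x n (Φ n (x (par n))), by rw [hu 0 hn, hx0], fun k hk hkn => ?_⟩
      rcases Nat.lt_succ_iff_lt_or_eq.1 hkn with hkn' | rfl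
      · rw [hu k hkn', hu _ ((hpar k hk hkn).trans hkn'), hx k hk hkn']
      · rw [Function.update_self, hu _ (hpar k hk hkn)]

/-- The degree of `j` in the tree on `0, …, n - 1` given by `par`. -/
def treeDegree (n : ℕ) (par : ℕ → ℕ) (j : ℕ) : ℕ :=
  #{k ∈ Ico 1 n | par k = j} + if 0 < j then 1 else 0

theorem sum_colorDegree {c : ℕ} (col : ℕ → Fin c) (j : ℕ) :
    ∑ i, colorDegree n par col j i = treeDegree n par j := by
  simp only [colorDegree, treeDegree, sum_add_distrib]
  congr 1
  · rw [card_eq_sum_card_fiberwise (f := col) (t := univ) (by simp)]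
    simp only [filter_filter]
  · by_cases hj : 0 < j <;> simp [hj]

theorem treeDegree_le {j : ℕ} (hn : 0 < n) : treeDegree n par j ≤ n := by
  have h1 : #{k ∈ Ico 1 n | par k = j} ≤ n - 1 := (card_filter_le _ _).trans (by simp)
  unfold treeDegree
  split_ifs <;> omega

theorem colorDegree_le_treeDegree {c : ℕ} (col : ℕ → Fin c) (j : ℕ) (i : Fin c) :
    colorDegree n par col j i ≤ treeDegree n par j := by
  rw [← sum_colorDegree col]
  exact single_le_sum (f := fun i => colorDegree n par col j i) (fun _ _ => Nat.zero_le _)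
    (mem_univ i)

/-- Degrees above `n` are never attained. -/
theorem HasColoring.exists_le {c : ℕ} {b : Fin c → ℕ} (h : HasColoring n par b) (hn : 0 < n) :
    ∃ b' : Fin c → ℕ, (∀ i, b' i ≤ n) ∧ HasColoring n par b' := by
  obtain ⟨col, hcol⟩ := h
  refine ⟨fun i => min (b i) n, fun i => min_le_right _ _, col, fun j hj i => ?_⟩
  have h1 := (colorDegree_le_treeDegree (n := n) (par := par) col j i).trans (treeDegree_le hn)
  have h2 := hcol j hj i
  dsimp only
  omega

theorem HasColoring.comp {c : ℕ} {b : Fin c → ℕ} (h : HasColoring n par b)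
    (σ : Equiv.Perm (Fin c)) : HasColoring n par (b ∘ σ) := by
  obtain ⟨col, hcol⟩ := h
  refine ⟨fun k => σ.symm (col k), fun j hj i => ?_⟩
  have := hcol j hj (σ i)
  simpa [colorDegree, Equiv.symm_apply_eq] using this

/-! ### Feasibility by Hall's theorem -/

/-- Hall's theorem with capacities: the elements of `K` get colours from their lists `S k` so that
colour `i` is used `d i` times. -/
theorem exists_assignment {ι κ : Type*} [Fintype ι] [DecidableEq ι] [Nonempty ι]
    (K : Finset κ) (S : κ → Finset ι) (d : ι → ℕ)
    (hall : ∀ A, #{k ∈ K | S k ⊆ A} ≤ ∑ i ∈ A, d i) (hcard : ∑ i, d i ≤ #K) :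
    ∃ f : κ → ι, (∀ k ∈ K, f k ∈ S k) ∧ ∀ i, #{k ∈ K | f k = i} = d i := by
  classical
  obtain ⟨g, hg, hgt⟩ := (all_card_le_biUnion_card_iff_exists_injective
    (fun k : K => (S k).sigma fun i => (univ : Finset (Fin (d i))))).1 (by
      intro X
      have h1 : X.biUnion (fun k : K => (S k).sigma fun i => (univ : Finset (Fin (d i)))) =
          (X.biUnion fun k => S k).sigma fun i => univ := by
        ext x
        simp
      rw [h1, card_sigma]
      simp only [card_univ, Fintype.card_fin]
      refine le_trans ?_ (hall _)
      rw [← card_image_of_injective X Subtype.val_injective]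
      refine card_le_card fun k hk => ?_
      obtain ⟨k, hkX, rfl⟩ := mem_image.1 hk
      rw [mem_filter]
      exact ⟨k.2, subset_biUnion_of_mem (fun k : K => S k) hkX⟩)
  have hf : ∀ k (hk : k ∈ K), (fun k => if hk : k ∈ K then (g ⟨k, hk⟩).1 else
      Classical.arbitrary ι) k = (g ⟨k, hk⟩).1 := fun k hk => dif_pos hk
  generalize (fun k => if hk : k ∈ K then (g ⟨k, hk⟩).1 else Classical.arbitrary ι) = f at hf
  have hle : ∀ i ∈ univ, #{k ∈ K | f k = i} ≤ d i := by
    intro i _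
    rw [← Fintype.card_fin (d i), ← card_univ, ← Fintype.card_coe]
    have hx : ∀ x : {k // k ∈ ({k ∈ K | f k = i} : Finset κ)}, x.1 ∈ K ∧ f x.1 = i := fun x =>
      mem_filter.1 x.2
    refine Fintype.card_le_of_injective (β := Fin (d i))
      (fun x => (hf x.1 (hx x).1 ▸ (hx x).2 : (g ⟨x.1, (hx x).1⟩).1 = i) ▸ (g ⟨x.1, (hx x).1⟩).2)
      fun x y hxy => ?_
    have key : ∀ (p q : Σ i, Fin (d i)) (hp : p.1 = i) (hq : q.1 = i),
        hp ▸ p.2 = (hq ▸ q.2 : Fin (d i)) → p = q := by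
      rintro ⟨p, p'⟩ ⟨q, q'⟩ rfl hq h
      obtain rfl : q = p := hq
      simp at h
      rw [h]
    have := hg (key _ _ _ _ hxy)
    exact Subtype.ext (Subtype.mk.inj this)
  have hsum : ∑ i, #{k ∈ K | f k = i} = ∑ i, d i :=
    le_antisymm (sum_le_sum hle)
      (by rwa [← card_eq_sum_card_fiberwise (f := f) (t := univ) (by simp)])
  refine ⟨f, fun k hk => ?_, fun i => (sum_eq_sum_iff_of_le hle).1 hsum i (mem_univ i)⟩
  rw [hf k hk]
  exact (mem_sigma.1 (hgt ⟨k, hk⟩)).1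

variable {c : ℕ}

/-- The degree `0`, `1` or `b i` that the choice `δ` selects in colour `i`. -/
def chosenDegree (b : Fin c → ℕ) (δ : Fin c → Fin 3) (i : Fin c) : ℕ :=
  if δ i = 0 then 0 else if δ i = 1 then 1 else b i

/-- Suppose that `h A` children of a vertex can have the colour of their parent edge only in `A`,
for each set `A` of colours. By Hall's theorem, this is the condition that the edges to the children
can be coloured, the edge to the parent having colour `p` (or `none` at the root), so that the
number of edges of each colour `i` is `0`, `1` or `b i`. -/
def CanExtend (b : Fin c → ℕ) (h : Finset (Fin c) → ℕ) (p : Option (Fin c)) : Prop :=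
  ∃ δ : Fin c → Fin 3,
    (∀ A, h A + (∑ i ∈ A, if p = some i then 1 else 0) ≤ ∑ i ∈ A, chosenDegree b δ i) ∧
      ∑ i, chosenDegree b δ i ≤ h univ + ∑ i, if p = some i then 1 else 0

/-- Among the vertices `lo, …, n - 1`, the number of children of `j` whose list of colours is
contained in `A`. -/
def childCount (lo n : ℕ) (par : ℕ → ℕ) (S : ℕ → Finset (Fin c)) (j : ℕ) (A : Finset (Fin c)) :
    ℕ :=
  #{k ∈ Ico lo n | par k = j ∧ S k ⊆ A}

/-- `S k` lists, for `lo ≤ k < n`, the colours `p` such that the edges below `k` can be coloured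
when the edge from `k` to its parent has colour `p`; the list is determined by those of the
children. -/
def IsColorTable (lo n : ℕ) (par : ℕ → ℕ) (b : Fin c → ℕ) (S : ℕ → Finset (Fin c)) : Prop :=
  ∀ k, lo ≤ k → k < n → ∀ p, p ∈ S k ↔ CanExtend b (childCount 1 n par S k) (some p)

theorem exists_chosenDegree {b : Fin c → ℕ} {d : Fin c → ℕ}
    (hd : ∀ i, d i = 0 ∨ d i = 1 ∨ d i = b i) :
    ∃ δ : Fin c → Fin 3, ∀ i, chosenDegree b δ i = d i := by
  have : ∀ i, ∃ x : Fin 3, (if x = 0 then 0 else if x = 1 then 1 else b i) = d i := by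
    intro i
    rcases hd i with h | h | h
    · exact ⟨0, by simp [h]⟩
    · exact ⟨1, by simp [h]⟩
    · exact ⟨2, by simp [h]⟩
  choose δ hδ using this
  exact ⟨δ, hδ⟩

theorem chosenDegree_eq_or (b : Fin c → ℕ) (δ : Fin c → Fin 3) (i : Fin c) :
    chosenDegree b δ i = 0 ∨ chosenDegree b δ i = 1 ∨ chosenDegree b δ i = b i := by
  unfold chosenDegree
  split_ifs <;> simp

theorem IsColorTable.canExtend_of_coloring {b : Fin c → ℕ} {S : ℕ → Finset (Fin c)}
    (hS : IsColorTable 1 n par b S) (hpar : ∀ k, 0 < k → k < n → par k < k)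
    {col : ℕ → Fin c} (hcol : ∀ j < n, ∀ i, colorDegree n par col j i = 0 ∨
      colorDegree n par col j i = 1 ∨ colorDegree n par col j i = b i) (m : ℕ) :
    ∀ j < n, n - j ≤ m →
      CanExtend b (childCount 1 n par S j) (if 0 < j then some (col j) else none) := by
  induction m with
  | zero => intros; omega
  | succ m ih =>
    intro j hj hjm
    have hchild : ∀ k ∈ ({k ∈ Ico 1 n | par k = j} : Finset ℕ), col k ∈ S k := by
      intro k hk
      rw [mem_filter, mem_Ico] at hk
      have := hpar k hk.1.1 hk.1.2
      rw [hS k hk.1.1 hk.1.2]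
      have h0 : 0 < k := hk.1.1
      simpa [h0] using ih k hk.1.2 (by omega)
    obtain ⟨δ, hδ⟩ := exists_chosenDegree (hcol j hj)
    have hp : ∀ i, (if (if 0 < j then some (col j) else none) = some i then 1 else 0) =
        if 0 < j ∧ col j = i then 1 else 0 := by
      intro i
      by_cases h0 : 0 < j <;> simp [h0]
    have hcount : ∀ A : Finset (Fin c), ∑ i ∈ A, #{k ∈ Ico 1 n | par k = j ∧ col k = i} =
        #{k ∈ Ico 1 n | par k = j ∧ col k ∈ A} := by
      intro A
      rw [card_eq_sum_card_fiberwise (f := col) (t := A) (fun k hk => by simp at hk; simp [hk])]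
      refine sum_congr rfl fun i hi => ?_
      rw [filter_filter]
      congr 1
      refine filter_congr fun k _ => ?_
      constructor
      · rintro ⟨h1, rfl⟩
        exact ⟨⟨h1, hi⟩, rfl⟩
      · rintro ⟨⟨h1, -⟩, h2⟩
        exact ⟨h1, h2⟩
    refine ⟨δ, fun A => ?_, ?_⟩
    · simp only [hδ, hp, colorDegree, sum_add_distrib, hcount]
      refine Nat.add_le_add_right (card_le_card fun k hk => ?_) _
      simp only [mem_filter] at hk ⊢
      exact ⟨hk.1, hk.2.1, hk.2.2 (hchild k (by simp [mem_Ico.1 hk.1, hk.2.1]))⟩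
    · simp only [hδ, hp, colorDegree, sum_add_distrib, hcount]
      refine Nat.add_le_add_right (card_le_card fun k hk => ?_) _
      simp only [mem_filter] at hk ⊢
      exact ⟨hk.1, hk.2.1, subset_univ _⟩

theorem CanExtend.exists_assignment [NeZero c] {b : Fin c → ℕ} {S : ℕ → Finset (Fin c)} {j : ℕ}
    {p : Option (Fin c)} (h : CanExtend b (childCount 1 n par S j) p) :
    ∃ f : ℕ → Fin c, (∀ k, 0 < k → k < n → par k = j → f k ∈ S k) ∧
      ∀ i, ∃ d, (d = 0 ∨ d = 1 ∨ d = b i) ∧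
        #{k ∈ Ico 1 n | par k = j ∧ f k = i} + (if p = some i then 1 else 0) = d := by
  obtain ⟨δ, h1, h2⟩ := h
  have hle : ∀ i, (if p = some i then 1 else 0) ≤ chosenDegree b δ i := by
    intro i
    have := h1 {i}
    simp only [sum_singleton] at this
    omega
  have hsub : ∀ A : Finset (Fin c),
      ∑ i ∈ A, (chosenDegree b δ i - if p = some i then 1 else 0) =
        ∑ i ∈ A, chosenDegree b δ i - ∑ i ∈ A, if p = some i then 1 else 0 := fun A =>
    sum_tsub_distrib A fun i _ => hle i
  obtain ⟨f, hfS, hf⟩ := SimpleGraph.exists_assignment {k ∈ Ico 1 n | par k = j} S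
    (fun i => chosenDegree b δ i - if p = some i then 1 else 0)
    (fun A => by
      have := h1 A
      rw [hsub, filter_filter]
      unfold childCount at this
      omega)
    (by
      rw [hsub]
      simp only [childCount, subset_univ, and_true] at h2
      omega)
  refine ⟨f, fun k hk hkn hkj => hfS k (by simp [hkj]; omega), fun i => ⟨chosenDegree b δ i,
    chosenDegree_eq_or b δ i, ?_⟩⟩
  have h3 := hf i
  have h4 := hle i
  rw [filter_filter] at h3
  omega

theorem IsColorTable.hasColoring_iff [NeZero c] {b : Fin c → ℕ} {S : ℕ → Finset (Fin c)}
    (hS : IsColorTable 1 n par b S) (hpar : ∀ k, 0 < k → k < n → par k < k) (hn : 0 < n) :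
    HasColoring n par b ↔ CanExtend b (childCount 1 n par S 0) none := by
  constructor
  · rintro ⟨col, hcol⟩
    simpa using hS.canExtend_of_coloring hpar hcol n 0 hn le_rfl
  · intro hroot
    have hF : ∀ j p, ∃ f : ℕ → Fin c, CanExtend b (childCount 1 n par S j) p →
        (∀ k, 0 < k → k < n → par k = j → f k ∈ S k) ∧
        ∀ i, ∃ d, (d = 0 ∨ d = 1 ∨ d = b i) ∧
          #{k ∈ Ico 1 n | par k = j ∧ f k = i} + (if p = some i then 1 else 0) = d := by
      intro j p
      by_cases h : CanExtend b (childCount 1 n par S j) p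
      · obtain ⟨f, hf⟩ := h.exists_assignment
        exact ⟨f, fun _ => hf⟩
      · exact ⟨fun _ => 0, fun h' => absurd h' h⟩
    choose F hF using hF
    -- Choose the colours from the root downwards; `x k` is the colour of the parent edge of `k`.
    obtain ⟨x, hx0, hx⟩ := exists_rec_parent hpar none fun k p => some (F (par k) p k)
    have hext : ∀ k < n, CanExtend b (childCount 1 n par S k) (x k) := by
      intro k
      induction k using Nat.strong_induction_on with
      | _ k ih =>
        intro hkn
        rcases Nat.eq_zero_or_pos k with rfl | hk
        · rwa [hx0]
        · have hp := hpar k hk hkn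
          rw [hx k hk hkn, ← hS k hk hkn]
          exact (hF _ _ (ih _ hp (hp.trans hkn))).1 k hk hkn rfl
    refine ⟨fun k => F (par k) (x (par k)) k, fun j hj i => ?_⟩
    obtain ⟨d, hd, hdi⟩ := (hF j (x j) (hext j hj)).2 i
    have : colorDegree n par (fun k => F (par k) (x (par k)) k) j i = d := by
      rw [← hdi, colorDegree]
      congr 1
      · congr 1
        refine filter_congr fun k _ => and_congr_right ?_
        rintro rfl
        rfl
      · rcases Nat.eq_zero_or_pos j with rfl | h0
        · simp [hx0]
        · simp [h0, hx j h0 hj]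
    rwa [this]

/-! ### Two colours: a linear number of candidate degrees -/

/-- With two colours, a vertex of maximum degree `D` gives a linear equation for the two degrees, so
that one of them may be computed from the other. -/
theorem HasColoring.exists_candidate {b : Fin 2 → ℕ} {D : ℕ} (h : HasColoring n par b)
    (hn : 0 < n) (hD : ∀ j < n, treeDegree n par j ≤ D) (hD' : ∃ j < n, treeDegree n par j = D) :
    ∃ x ≤ n, HasColoring n par ![x, D] ∨ HasColoring n par ![x, D - 1] ∨
      HasColoring n par ![x, D - x] := by
  obtain ⟨b, hb, h⟩ := h.exists_le hn
  have hswap := h.comp (Equiv.swap 0 1)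
  have heq : b = ![b 0, b 1] := by
    ext i
    fin_cases i <;> rfl
  have heq' : b ∘ Equiv.swap 0 1 = ![b 1, b 0] := by
    ext i
    fin_cases i <;> simp
  rw [heq'] at hswap
  rw [heq] at h
  obtain ⟨col, hcol⟩ := id h
  obtain ⟨j, hj, hjD⟩ := hD'
  have hsum : colorDegree n par col j 0 + colorDegree n par col j 1 = D := by
    rw [← hjD, ← sum_colorDegree col, Fin.sum_univ_two]
  have h0 := hcol j hj 0
  have h1 := hcol j hj 1
  simp only [Matrix.cons_val_zero, Matrix.cons_val_one] at h0 h1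
  by_cases h2 : D ≤ 2
  · -- The tree is a path: a single colour suffices.
    refine ⟨D, hjD ▸ treeDegree_le hn, Or.inl ⟨fun _ => 0, fun j hj i => ?_⟩⟩
    have h3 := colorDegree_le_treeDegree (n := n) (par := par) (fun _ => (0 : Fin 2)) j i
    have h4 := hD j hj
    have h5 : ![D, D] i = D := by fin_cases i <;> rfl
    rw [h5]
    omega
  · have key : b 1 = D ∨ b 1 = D - 1 ∨ b 0 = D ∨ b 0 = D - 1 ∨ b 1 = D - b 0 := by omega
    rcases key with h3 | h3 | h3 | h3 | h3
    · exact ⟨b 0, hb 0, Or.inl (h3 ▸ h)⟩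
    · exact ⟨b 0, hb 0, Or.inr (Or.inl (h3 ▸ h))⟩
    · exact ⟨b 1, hb 1, Or.inl (h3 ▸ hswap)⟩
    · exact ⟨b 1, hb 1, Or.inr (Or.inl (h3 ▸ hswap))⟩
    · exact ⟨b 0, hb 0, Or.inr (Or.inr (h3 ▸ h))⟩

/-! ### The logarithmic bound -/

/-- Binary expansion: a set of fewer than `2 ^ m` elements is split into parts, at most one of each
size `2 ^ a` with `a < m`. -/
theorem exists_binary_split {κ : Type*} (m : ℕ) (K : Finset κ) (hK : #K < 2 ^ m) :
    ∃ f : κ → ℕ, (∀ k ∈ K, f k < m) ∧ ∀ a, #{k ∈ K | f k = a} = 0 ∨ #{k ∈ K | f k = a} = 2 ^ a := by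
  classical
  induction m generalizing K with
  | zero =>
    obtain rfl : K = ∅ := by simpa using hK
    exact ⟨fun _ => 0, by simp⟩
  | succ m ih =>
    by_cases hm : #K < 2 ^ m
    · obtain ⟨f, hf, h⟩ := ih K hm
      exact ⟨f, fun k hk => (hf k hk).trans (Nat.lt_succ_self m), h⟩
    · obtain ⟨L, hLK, hL⟩ := exists_subset_card_eq (not_lt.1 hm)
      obtain ⟨f, hf, h⟩ := ih (K \ L) (by
        rw [card_sdiff_of_subset hLK]
        rw [pow_succ] at hK
        omega)
      refine ⟨fun k => if k ∈ L then m else f k, fun k hk => ?_, fun a => ?_⟩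
      · dsimp only
        split_ifs with hkL
        · exact Nat.lt_succ_self m
        · exact (hf k (mem_sdiff.2 ⟨hk, hkL⟩)).trans (Nat.lt_succ_self m)
      · by_cases ha : a = m
        · right
          subst ha
          rw [← hL]
          congr 1
          ext k
          rw [mem_filter]
          constructor
          · rintro ⟨hk, hka⟩
            by_contra hkL
            replace hka : f k = a := by simpa [hkL] using hka
            have := hf k (mem_sdiff.2 ⟨hk, hkL⟩)
            omega
          · exact fun hk => ⟨hLK hk, if_pos hk⟩
        · have : ({k ∈ K | (if k ∈ L then m else f k) = a} : Finset κ) =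
              {k ∈ K \ L | f k = a} := by
            ext k
            simp only [mem_filter, mem_sdiff]
            by_cases hkL : k ∈ L
            · simp [hkL, Ne.symm ha]
            · simp [hkL]
          rw [this]
          exact h a

/-- The edges below the vertices of even depth and those below the vertices of odd depth use
disjoint sets of colours, with degrees `1, 2, 4, …`; then the edge to the parent does not interfere
with the binary expansion of the number of children. -/
theorem exists_hasColoring_of_card_lt (hpar : ∀ k, 0 < k → k < n → par k < k) {m : ℕ} (hm : 0 < m)
    (hdeg : ∀ j < n, #{k ∈ Ico 1 n | par k = j} < 2 ^ m) :
    ∃ b : Fin (2 * m) → ℕ, HasColoring n par b := by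
  have hf : ∀ j, ∃ f : ℕ → ℕ, j < n → (∀ k ∈ ({k ∈ Ico 1 n | par k = j} : Finset ℕ), f k < m) ∧
      ∀ a, #{k ∈ Ico 1 n | par k = j ∧ f k = a} = 0 ∨
        #{k ∈ Ico 1 n | par k = j ∧ f k = a} = 2 ^ a := by
    intro j
    by_cases hj : j < n
    · obtain ⟨f, hf⟩ := exists_binary_split m _ (hdeg j hj)
      simp only [filter_filter] at hf
      exact ⟨f, fun _ => hf⟩
    · exact ⟨fun _ => 0, fun h => absurd h hj⟩
  choose f hf using hf
  obtain ⟨x, -, hx⟩ := exists_rec_parent hpar 0 fun _ y => 1 - y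
  have hcol : ∀ k, ∃ i : Fin (2 * m), 0 < k → k < n →
      (i : ℕ) = 2 * f (par k) k + (1 - x (par k)) := by
    intro k
    by_cases hk : 0 < k ∧ k < n
    · have := (hf _ ((hpar k hk.1 hk.2).trans hk.2)).1 k (by simp; omega)
      exact ⟨⟨2 * f (par k) k + (1 - x (par k)), by omega⟩, fun _ _ => rfl⟩
    · exact ⟨⟨0, by omega⟩, fun h1 h2 => absurd ⟨h1, h2⟩ hk⟩
  choose col hcol using hcol
  refine ⟨fun i => 2 ^ ((i : ℕ) / 2), col, fun j hj i => ?_⟩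
  by_cases hi : (i : ℕ) % 2 = 1 - x j
  · have hp : ¬ (0 < j ∧ col j = i) := by
      rintro ⟨h0, rfl⟩
      have h1 := hcol j h0 hj
      have h2 := hx j h0 hj
      omega
    have : colorDegree n par col j i = #{k ∈ Ico 1 n | par k = j ∧ f j k = (i : ℕ) / 2} := by
      rw [colorDegree, if_neg hp, add_zero]
      congr 1
      refine filter_congr fun k hk => and_congr_right ?_
      rintro rfl
      rw [mem_Ico] at hk
      have := hcol k hk.1 hk.2
      rw [Fin.ext_iff]
      omega
    rw [this]
    have := (hf j hj).2 ((i : ℕ) / 2)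
    tauto
  · have : #{k ∈ Ico 1 n | par k = j ∧ col k = i} = 0 := by
      rw [card_eq_zero, filter_eq_empty_iff]
      rintro k hk ⟨rfl, rfl⟩
      rw [mem_Ico] at hk
      have := hcol k hk.1 hk.2
      omega
    rw [colorDegree, this]
    split_ifs <;> simp

theorem IsTree.wr_le_two_mul_logb {V : Type*} [Fintype V] (T : SimpleGraph V)
    [DecidableRel T.Adj] (hT : T.IsTree) :
    (T.wr : ℝ) ≤ 2 * Real.logb 2 (T.maxDegree : ℝ) + 2 := by
  classical
  obtain ⟨e, par, h⟩ := hT.exists_isGrowth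
  have hwr : T.wr ≤ 2 * (Nat.log 2 T.maxDegree + 1) := by
    refine (h.wr_le_iff hT rfl (by omega)).2
      (exists_hasColoring_of_card_lt h.lt (Nat.succ_pos _) fun j hj => ?_)
    calc #{k ∈ Ico 1 (Fintype.card V) | par k = j} ≤ T.degree (e j) := by
          have h1 := h.ncard_neighbors hT rfl Set.univ hj
          simp only [Set.mem_univ, and_true] at h1
          have h2 : {w | T.Adj (e j) w} = (T.neighborFinset (e j) : Set V) := by
            ext w
            simp
          rw [h2, Set.ncard_coe_finset, card_neighborFinset_eq_degree] at h1
          omega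
      _ ≤ T.maxDegree := T.degree_le_maxDegree _
      _ < 2 ^ (Nat.log 2 T.maxDegree + 1) := Nat.lt_pow_succ_log_self (by norm_num) _
  have hlog : (Nat.log 2 T.maxDegree : ℝ) ≤ Real.logb 2 T.maxDegree := by
    exact_mod_cast Real.natLog_le_logb T.maxDegree 2
  have : (T.wr : ℝ) ≤ 2 * ((Nat.log 2 T.maxDegree : ℝ) + 1) := by exact_mod_cast hwr
  linarith

end SimpleGraph

/-! ### Reasoning about programs -/

namespace RAM

@[simp] theorem State.reg_setReg (s : State) (x v y : ℕ) :
    (s.setReg x v).reg y = if y = x then v else s.reg y := by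
  simp [State.setReg, Function.update_apply]

@[simp] theorem State.arr_setReg (s : State) (x v : ℕ) : (s.setReg x v).arr = s.arr := rfl

@[simp] theorem State.reg_setArr (s : State) (a i v : ℕ) : (s.setArr a i v).reg = s.reg := rfl

@[simp] theorem State.arr_setArr (s : State) (a i v b j : ℕ) :
    (s.setArr a i v).arr b j = if b = a ∧ j = i then v else s.arr b j := by
  by_cases hb : b = a
  · subst hb
    simp [State.setArr, Function.update_apply]
  · simp [State.setArr, hb]

/-- The program `p`, started in `s`, halts after at most `t` steps in a state satisfying `Q`. -/
def Runs (W t : ℕ) (p : Program) (s : State) (Q : State → Prop) : Prop :=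
  ∃ t' s', Exec W p s t' s' ∧ t' ≤ t ∧ Q s'

namespace Runs

variable {W t t₁ t₂ : ℕ} {p q : Program} {s : State} {P Q R : State → Prop}

theorem mono (h : Runs W t₁ p s P) (ht : t₁ ≤ t₂) (hPQ : ∀ s', P s' → Q s') :
    Runs W t₂ p s Q := by
  obtain ⟨t, s', he, ht', hP⟩ := h
  exact ⟨t, s', he, ht'.trans ht, hPQ s' hP⟩

theorem seq (hp : Runs W t₁ p s P) (hq : ∀ s', P s' → Runs W t₂ q s' Q) :
    Runs W (t₁ + t₂) (.seq p q) s Q := by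
  obtain ⟨t, s', he, ht, hP⟩ := hp
  obtain ⟨t', s'', he', ht', hQ⟩ := hq s' hP
  exact ⟨t + t', s'', he.seq he', Nat.add_le_add ht ht', hQ⟩

/-- A loop of at most `N` iterations with an invariant `I i` after `i` iterations. -/
theorem loop {b : Test} {N : ℕ} {I : ℕ → State → Prop}
    (hstep : ∀ i < N, ∀ s, I i s → b.Holds s ∧ Runs W t p s (I (i + 1)))
    (hend : ∀ s, I N s → ¬ b.Holds s) (hs : I 0 s) :
    Runs W (N * (t + 1) + 1) (.loop b p) s (I N) := by
  have key : ∀ m ≤ N, ∀ s, I (N - m) s → Runs W (m * (t + 1) + 1) (.loop b p) s (I N) := by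
    intro m
    induction m with
    | zero => exact fun _ s hs => ⟨1, s, .loop_false (hend s hs), by simp, hs⟩
    | succ m ih =>
      intro hm s hs
      obtain ⟨hb, t', s', he, ht', hs'⟩ := hstep _ (by omega) s hs
      rw [show N - (m + 1) + 1 = N - m by omega] at hs'
      obtain ⟨t'', s'', he', ht'', hs''⟩ := ih (by omega) s' hs'
      refine ⟨t' + t'' + 1, s'', .loop_true hb he he', ?_, hs''⟩
      rw [Nat.succ_mul]
      omega
  exact key N le_rfl s (by simpa using hs)

end Runs

/-- An upper bound for the running time of a program without loops. -/
def Program.cost : Program → ℕ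
  | .skip => 0
  | .instr _ => 1
  | .seq p q => p.cost + q.cost
  | .ite _ p q => p.cost + q.cost + 1
  | .loop _ _ => 0

/-- The weakest precondition of a program without loops. -/
def wp (W : ℕ) : Program → (State → Prop) → State → Prop
  | .skip, Q, s => Q s
  | .instr c, Q, s => c.value s ≤ W ∧ Q (c.exec s)
  | .seq p q, Q, s => wp W p (wp W q Q) s
  | .ite b p q, Q, s => (b.Holds s → wp W p Q s) ∧ (¬ b.Holds s → wp W q Q s)
  | .loop _ _, _, _ => False

variable {W : ℕ}

theorem wp_mono {p : Program} {P Q : State → Prop} (h : ∀ s, P s → Q s) {s : State}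
    (hp : wp W p P s) : wp W p Q s := by
  induction p generalizing P Q s with
  | skip => exact h s hp
  | instr c => exact ⟨hp.1, h _ hp.2⟩
  | seq p q ihp ihq => exact ihp (fun _ => ihq h) hp
  | ite b p q ihp ihq => exact ⟨fun hb => ihp h (hp.1 hb), fun hb => ihq h (hp.2 hb)⟩
  | loop b p => exact hp.elim

theorem Runs.of_wp {p : Program} {Q : State → Prop} {s : State} (h : wp W p Q s) :
    Runs W p.cost p s Q := by
  induction p generalizing Q s with
  | skip => exact ⟨0, s, .skip s, le_rfl, h⟩
  | instr c => exact ⟨1, _, .instr c s h.1, le_rfl, h.2⟩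
  | seq p q ihp ihq => exact (ihp h).seq fun s' hs' => ihq hs'
  | ite b p q ihp ihq =>
    by_cases hb : b.Holds s
    · obtain ⟨t, s', he, ht, hQ⟩ := ihp (h.1 hb)
      exact ⟨t + 1, s', .ite_true hb he, by simp only [Program.cost]; omega, hQ⟩
    · obtain ⟨t, s', he, ht, hQ⟩ := ihq (h.2 hb)
      exact ⟨t + 1, s', .ite_false hb he, by simp only [Program.cost]; omega, hQ⟩
  | loop b p => exact h.elim

/-- The programs of a list, one after the other. -/
def seqs : List Program → Program
  | [] => .skip
  | p :: ps => .seq p (seqs ps)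

/-- The programs `f a` for the members `a` of a finite set, one after the other. -/
noncomputable def forEach {α : Type*} (A : Finset α) (f : α → Program) : Program :=
  seqs (A.toList.map f)

/-- The rule for `forEach`, with an invariant that depends on the set of members treated so far. -/
theorem wp_forEach {α : Type*} [DecidableEq α] {A : Finset α} {f : α → Program}
    {I : Finset α → State → Prop}
    (hstep : ∀ D, ∀ a ∈ A, a ∉ D → ∀ s, I D s → wp W (f a) (I (insert a D)) s)
    {s : State} (hs : I ∅ s) : wp W (forEach A f) (I A) s := by
  have key : ∀ (L : List α) (D : Finset α), L.Nodup → (∀ a ∈ L, a ∈ A ∧ a ∉ D) →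
      ∀ s, I D s → wp W (seqs (L.map f)) (I (D ∪ L.toFinset)) s := by
    intro L
    induction L with
    | nil => intro D _ _ s hs; simpa [seqs, wp] using hs
    | cons a L ih =>
      intro D hL hD s hs
      have ha := hD a (by simp)
      refine wp_mono (p := f a) (fun s' hs' => ?_) (hstep D a ha.1 ha.2 s hs)
      rw [List.nodup_cons] at hL
      rw [show D ∪ (a :: L).toFinset = insert a D ∪ L.toFinset by
        rw [List.toFinset_cons, Finset.insert_union, Finset.union_insert]]
      refine ih _ hL.2 (fun x hx => ⟨(hD x (by simp [hx])).1, ?_⟩) s' hs'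
      rw [Finset.mem_insert, not_or]
      exact ⟨fun hxa => hL.1 (hxa ▸ hx), (hD x (by simp [hx])).2⟩
  simpa [forEach] using key A.toList ∅ A.nodup_toList (by simp) s hs

end RAM

/-! ### Computing a growth from the edge list -/

namespace RAM

open SimpleGraph Finset

variable {n : ℕ} {T : SimpleGraph (Fin n)} {l : List (Fin n × Fin n)}

theorem IsEdgeList.length_add_one (hl : IsEdgeList T l) (hT : T.IsTree) : l.length + 1 = n := by
  classical
  have h1 : (l.map fun e => s(e.1, e.2)).toFinset = T.edgeFinset := by
    ext x
    induction x using Sym2.ind with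
    | _ u v => rw [List.mem_toFinset, hl.2 u v, mem_edgeFinset, mem_edgeSet]
  have h2 := List.toFinset_card_of_nodup hl.1
  rw [h1, List.length_map] at h2
  have h3 := hT.card_edgeFinset
  rw [Fintype.card_fin] at h3
  omega

/-- Register `9` holds the number `m` of vertices found. Put the vertex in register `v` next, as a
child of the vertex whose index plus one is in register `i`. -/
def addVertexProgram (v i : ℕ) : Program :=
  seqs [.instr (.sub 23 i 4), .instr (.store 3 9 23), .instr (.add 9 9 4), .instr (.store 2 v 9)]

/-- Look at the edge whose number is in register `13`; if exactly one of its ends has been found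
before, add the other one. -/
def scanEdgeProgram : Program :=
  seqs [.instr (.load 15 0 13), .instr (.load 17 1 13), .instr (.load 19 2 15),
    .instr (.load 21 2 17),
    .ite (.eq 19 2)
      (.ite (.eq 21 2) .skip (addVertexProgram 15 21))
      (.ite (.eq 21 2) (addVertexProgram 17 19) .skip),
    .instr (.add 13 13 4)]

/-- Scan the edge list `n` times, starting from the vertex `0`. In array `2`, a vertex that has been
found has its index plus one, and the others have `0`; array `3` holds the indices of the
parents. -/
def growProgram : Program :=
  .seq (seqs [.instr (.const 4 1), .instr (.sub 8 0 4), .instr (.store 2 2 4), .instr (.const 9 1),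
    .instr (.const 11 0)])
    (.loop (.lt 11 0) (seqs [.instr (.const 13 0), .loop (.lt 13 8) scanEdgeProgram,
      .instr (.add 11 11 4)]))

/-- The state during `growProgram`, when `m` vertices have been found. -/
structure Growing (T : SimpleGraph (Fin n)) (l : List (Fin n × Fin n)) (m : ℕ) (e : ℕ → Fin n)
    (par : ℕ → ℕ) (s : State) : Prop where
  growth : T.IsGrowth m e par
  pos : 0 < m
  reg_n : s.reg 0 = n
  reg_zero : s.reg 2 = 0
  reg_one : s.reg 4 = 1
  reg_pred : s.reg 8 = n - 1
  reg_m : s.reg 9 = m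
  arr_fst : ∀ i, s.arr 0 i = (input n l).arr 0 i
  arr_snd : ∀ i, s.arr 1 i = (input n l).arr 1 i
  found : ∀ k < m, s.arr 2 (e k) = k + 1
  not_found : ∀ v : Fin n, (∀ k < m, e k ≠ v) → s.arr 2 v = 0
  arr_par : ∀ k, 0 < k → k < m → s.arr 3 k = par k
  arr_zero : ∀ a, 4 ≤ a → ∀ i, s.arr a i = 0

variable {m : ℕ} {e : ℕ → Fin n} {par : ℕ → ℕ} {s : State} {W : ℕ}

theorem Growing.le (h : Growing T l m e par s) : m ≤ n := by
  simpa using h.growth.le_card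

theorem Growing.congr (h : Growing T l m e par s) {s' : State} (harr : s'.arr = s.arr)
    (hreg : ∀ x < 10, s'.reg x = s.reg x) : Growing T l m e par s' := by
  obtain ⟨h1, h2, h3, h4, h5, h6, h7, h8, h9, h10, h11, h12, h13⟩ := h
  constructor <;> simp_all

theorem Growing.wp_addVertex (h : Growing T l m e par s) (hW : n + 1 ≤ W) {x y i : ℕ} {v : Fin n}
    (hx : 9 < x) (hx' : x ≠ 23) (hv : s.reg x = v) (hi : i < m)
    (hyi : s.reg y = i + 1) (hadj : T.Adj v (e i)) (hnew : ∀ k < m, e k ≠ v) :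
    wp W (addVertexProgram x y) (fun s' => s'.reg 11 = s.reg 11 ∧ s'.reg 13 = s.reg 13 ∧
      ∃ e' par', Growing T l (m + 1) e' par' s') s := by
  have hm : m + 1 ≤ n := by simpa using (h.growth.update hi hnew hadj).le_card
  have hG := h.growth.update hi hnew hadj
  obtain ⟨h1, h2, h3, h4, h5, h6, h7, h8, h9, h10, h11, h12, h13⟩ := h
  simp only [addVertexProgram, seqs, wp, Instr.value, Instr.exec, State.reg_setReg,
    State.reg_setArr]
  have hx9 : x ≠ 9 := by omega
  simp only [h5, h7, hyi, hv, hx9, hx', if_true, if_false, Nat.reduceEqDiff]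
  refine ⟨by omega, by omega, by omega, by omega, by simp, by simp, _, _, hG, by omega, ?_, ?_, ?_,
    ?_, ?_, ?_, ?_, ?_, ?_, ?_, ?_⟩
  · simpa using h3
  · simpa using h4
  · simpa using h5
  · simpa using h6
  · simp
  · simpa using h8
  · simpa using h9
  · intro k hk
    rcases Nat.lt_succ_iff_lt_or_eq.1 hk with hk | rfl
    · have : (e k : ℕ) ≠ v := fun hkv => hnew k hk (Fin.ext hkv)
      simp [Function.update_of_ne hk.ne, this, h10 k hk]
    · simp
  · intro w hw
    have hwv : (w : ℕ) ≠ v := fun hwv => hw m (by omega) (by simp [Fin.ext hwv])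
    simp only [State.arr_setReg, State.arr_setArr, hwv, and_false, if_false, Nat.reduceEqDiff,
      false_and]
    refine h11 w fun k hk => ?_
    have := hw k (by omega)
    rwa [Function.update_of_ne hk.ne] at this
  · intro k hk hkm
    rcases Nat.lt_succ_iff_lt_or_eq.1 hkm with hkm | rfl
    · simp [hkm.ne, h12 k hk hkm]
    · simp
  · intro a ha i
    have h2 : a ≠ 2 := by omega
    have h3 : a ≠ 3 := by omega
    simp [h2, h3, h13 a ha]

theorem Growing.exists_or (h : Growing T l m e par s) (v : Fin n) :
    (∃ k < m, e k = v ∧ s.arr 2 v = k + 1) ∨ (∀ k < m, e k ≠ v) ∧ s.arr 2 v = 0 := by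
  by_cases hv : ∃ k < m, e k = v
  · obtain ⟨k, hk, rfl⟩ := hv
    exact Or.inl ⟨k, hk, rfl, h.found k hk⟩
  · push Not at hv
    exact Or.inr ⟨hv, h.not_found v hv⟩

/-- The invariant of one scan of the edge list, which starts with `m₀` vertices: a vertex has been
added, or none of the edges seen leaves the set of vertices found. -/
def Scanning (T : SimpleGraph (Fin n)) (l : List (Fin n × Fin n)) (r m₀ j : ℕ) (s : State) : Prop :=
  s.reg 11 = r ∧ s.reg 13 = j ∧ ∃ m e par, Growing T l m e par s ∧ m₀ ≤ m ∧
    (m₀ < m ∨ ∀ i < j, ∀ u v, l[i]? = some (u, v) → ((∃ k < m, e k = u) ↔ ∃ k < m, e k = v))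

theorem Scanning.wp_scanEdge {r m₀ j : ℕ} (h : Scanning T l r m₀ j s) (hT : T.IsTree)
    (hl : IsEdgeList T l) (hW : n + 1 ≤ W) (hj : j < n - 1) :
    wp W scanEdgeProgram (Scanning T l r m₀ (j + 1)) s := by
  obtain ⟨hr, hrj, m, e, par, h, hm, hor⟩ := h
  have hlen := hl.length_add_one hT
  have hjl : j < l.length := by omega
  obtain ⟨⟨u, v⟩, huv⟩ : ∃ p, l[j]? = some p := ⟨_, List.getElem?_eq_getElem hjl⟩
  have hu : s.arr 0 j = u := by simp [h.arr_fst, input, huv]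
  have hv : s.arr 1 j = v := by simp [h.arr_snd, input, huv]
  have hadj : T.Adj u v :=
    (hl.2 u v).1 (List.mem_map.2 ⟨(u, v), List.mem_of_getElem? huv, rfl⟩)
  have hone := h.reg_one
  have hzero := h.reg_zero
  have hmn := h.le
  have hun := u.2
  have hvn := v.2
  -- `t` is the state in which the comparisons are made.
  simp only [scanEdgeProgram, seqs, wp, Instr.value, Instr.exec]
  simp only [State.reg_setReg, State.arr_setReg, Nat.reduceEqDiff, if_true, if_false, hrj, hu, hv,
    Test.Holds, hzero]
  obtain ⟨t, ht⟩ : ∃ t, t = ((((s.setReg 15 u).setReg 17 v).setReg 19 (s.arr 2 u)).setReg 21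
    (s.arr 2 v)) := ⟨_, rfl⟩
  rw [← ht]
  have hGt : Growing T l m e par t := by
    refine h.congr (by simp [ht]) fun x hx => ?_
    have h1 : x ≠ 15 := by omega
    have h2 : x ≠ 17 := by omega
    have h3 : x ≠ 19 := by omega
    have h4 : x ≠ 21 := by omega
    simp [ht, h1, h2, h3, h4]
  have ht15 : t.reg 15 = u := by simp [ht]
  have ht17 : t.reg 17 = v := by simp [ht]
  have ht19 : t.reg 19 = s.arr 2 u := by simp [ht]
  have ht21 : t.reg 21 = s.arr 2 v := by simp [ht]
  have ht11 : t.reg 11 = r := by simp [ht, hr]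
  have ht13 : t.reg 13 = j := by simp [ht, hrj]
  -- The end of the program, when a vertex has been added and when none has been.
  have hadd : ∀ s' : State, (s'.reg 11 = t.reg 11 ∧ s'.reg 13 = t.reg 13 ∧
      ∃ e' par', Growing T l (m + 1) e' par' s') → s'.reg 13 + s'.reg 4 ≤ W ∧
        Scanning T l r m₀ (j + 1) (s'.setReg 13 (s'.reg 13 + s'.reg 4)) := by
    rintro s' ⟨h11, h13, e', par', hG⟩
    rw [h13, ht13, hG.reg_one]
    refine ⟨by omega, by simp [h11, ht11], by simp, m + 1, e', par',
      hG.congr rfl fun x hx => ?_, by omega, Or.inl (by omega)⟩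
    have h1 : x ≠ 13 := by omega
    simp [h1]
  have hskip : ((∃ k < m, e k = u) ↔ ∃ k < m, e k = v) → j + s.reg 4 ≤ W ∧
        Scanning T l r m₀ (j + 1) (t.setReg 13 (j + s.reg 4)) := by
    intro hiff
    rw [hone]
    refine ⟨by omega, by simp [ht11], by simp, m, e, par, hGt.congr rfl fun x hx => ?_, hm,
      hor.imp_right fun hor i hi u' v' huv' => ?_⟩
    · have h1 : x ≠ 13 := by omega
      simp [h1]
    · rcases Nat.lt_succ_iff_lt_or_eq.1 hi with hi | rfl
      · exact hor i hi u' v' huv'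
      · rw [huv] at huv'
        obtain ⟨rfl, rfl⟩ := Prod.mk.inj (Option.some.inj huv')
        exact hiff
  rcases h.exists_or u with ⟨k, hk, hku, hk2⟩ | ⟨hnu, hu2⟩ <;>
    rcases h.exists_or v with ⟨k', hk', hkv, hk2'⟩ | ⟨hnv, hv2⟩
  · rw [hk2, hk2']
    refine ⟨by omega, by omega, by omega, by omega, fun h0 => by omega, fun _ =>
      ⟨fun h0 => by omega, fun _ => hskip ?_⟩⟩
    exact iff_of_true ⟨k, hk, hku⟩ ⟨k', hk', hkv⟩
  · rw [hk2, hv2]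
    refine ⟨by omega, by omega, by omega, by omega, fun h0 => by omega, fun _ =>
      ⟨fun _ => wp_mono hadd ?_, fun h0 => by omega⟩⟩
    exact hGt.wp_addVertex hW (by norm_num) (by norm_num) ht17 hk
      (ht19.trans hk2) (hku ▸ hadj.symm) hnv
  · rw [hu2, hk2']
    refine ⟨by omega, by omega, by omega, by omega, fun _ =>
      ⟨fun h0 => by omega, fun _ => wp_mono hadd ?_⟩, fun h0 => by omega⟩
    exact hGt.wp_addVertex hW (by norm_num) (by norm_num) ht15 hk'
      (ht21.trans hk2') (hkv ▸ hadj) hnu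
  · rw [hu2, hv2]
    refine ⟨by omega, by omega, by omega, by omega, fun _ =>
      ⟨fun _ => hskip ?_, fun h0 => by omega⟩, fun h0 => by omega⟩
    exact iff_of_false (fun ⟨k, hk, hku⟩ => hnu k hk hku) fun ⟨k, hk, hkv⟩ => hnv k hk hkv

/-- A complete scan adds a vertex unless all have been found, since otherwise some edge leaves the
set of vertices found. -/
theorem Scanning.exists_growing {r m₀ : ℕ} (h : Scanning T l r m₀ (n - 1) s) (hT : T.IsTree)
    (hl : IsEdgeList T l) : s.reg 11 = r ∧ ∃ m e par, Growing T l m e par s ∧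
      min (m₀ + 1) n ≤ m := by
  obtain ⟨hr, -, m, e, par, h, hm, hor⟩ := h
  refine ⟨hr, m, e, par, h, ?_⟩
  by_contra hcon
  have hlen := hl.length_add_one hT
  have hor := hor.resolve_left (by omega)
  obtain ⟨i, hi, v, hv, hadj⟩ := h.growth.exists_crossing hT.connected h.pos (by simp; omega)
  obtain ⟨p, hp, hpv⟩ := List.mem_map.1 ((hl.2 v (e i)).2 hadj)
  obtain ⟨j, hj, hjp⟩ := List.mem_iff_getElem.1 hp
  have hiff := hor j (by omega) p.1 p.2 (by rw [List.getElem?_eq_getElem hj, hjp])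
  rcases Sym2.eq_iff.1 hpv with ⟨h1, h2⟩ | ⟨h1, h2⟩ <;> rw [h1, h2] at hiff
  · obtain ⟨k, hk, hkv⟩ := hiff.2 ⟨i, hi, rfl⟩
    exact hv k hk hkv
  · obtain ⟨k, hk, hkv⟩ := hiff.1 ⟨i, hi, rfl⟩
    exact hv k hk hkv

/-- The program `growProgram` computes the parent function of a growth in quadratic time. -/
theorem runs_growProgram : ∃ K, ∀ (n W : ℕ) (T : SimpleGraph (Fin n)) (l : List (Fin n × Fin n)),
    T.IsTree → IsEdgeList T l → n + 1 ≤ W →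
      Runs W (K * (n + 1) ^ 2) growProgram (input n l)
        (fun s => ∃ e par, Growing T l n e par s) := by
  refine ⟨scanEdgeProgram.cost + 20, fun n W T l hT hl hW => ?_⟩
  have hlen := hl.length_add_one hT
  have hn : 0 < n := by omega
  set c := scanEdgeProgram.cost with hc
  let I : ℕ → State → Prop := fun r s => s.reg 11 = r ∧
    ∃ m e par, Growing T l m e par s ∧ min (r + 1) n ≤ m
  -- One scan.
  have hbody : ∀ r < n, ∀ s, I r s → (Test.lt 11 0).Holds s ∧
      Runs W ((c + 2) * (n + 1)) (seqs [.instr (.const 13 0), .loop (.lt 13 8) scanEdgeProgram,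
        .instr (.add 11 11 4)]) s (I (r + 1)) := by
    rintro r hr s ⟨hsr, m, e, par, hG, hm⟩
    refine ⟨by simpa [Test.Holds, hsr, hG.reg_n] using hr, ?_⟩
    have h1 : Runs W 1 (.instr (.const 13 0)) s (Scanning T l r m 0) := by
      refine Runs.of_wp (p := .instr (.const 13 0)) ?_
      simp only [wp, Instr.value, Instr.exec]
      refine ⟨by omega, by simp [hsr], by simp, m, e, par, hG.congr rfl fun x hx => ?_, le_rfl,
        Or.inr (by intros; omega)⟩
      have h1 : x ≠ 13 := by omega
      simp [h1]
    have h2 : ∀ s, Scanning T l r m 0 s → Runs W ((n - 1) * (c + 1) + 1)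
        (.loop (.lt 13 8) scanEdgeProgram) s (Scanning T l r m (n - 1)) := by
      intro s hs
      refine Runs.loop (fun j hj s hs => ⟨?_, Runs.of_wp (hs.wp_scanEdge hT hl hW hj)⟩)
        (fun s hs => ?_) hs
      · obtain ⟨-, hsj, m, e, par, hG, -⟩ := hs
        simpa [Test.Holds, hsj, hG.reg_pred] using hj
      · obtain ⟨-, hsj, m, e, par, hG, -⟩ := hs
        simp [Test.Holds, hsj, hG.reg_pred]
    have h3 : ∀ s, Scanning T l r m (n - 1) s → Runs W 1
        (seqs [.instr (.add 11 11 4)]) s (I (r + 1)) := by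
      intro s hs
      obtain ⟨hsr, m', e', par', hG', hm'⟩ := hs.exists_growing hT hl
      refine Runs.of_wp (p := seqs [.instr (.add 11 11 4)]) ?_
      simp only [seqs, wp, Instr.value, Instr.exec, hsr, hG'.reg_one]
      refine ⟨by omega, by simp, m', e', par', hG'.congr rfl fun x hx => ?_, by omega⟩
      have h1 : x ≠ 11 := by omega
      simp [h1]
    refine (h1.seq fun s hs => (h2 s hs).seq h3).mono ?_ fun _ h => h
    obtain ⟨k, rfl⟩ : ∃ k, n = k + 1 := ⟨n - 1, by omega⟩
    rw [Nat.add_sub_cancel]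
    nlinarith
  have hloop : ∀ s, I 0 s → Runs W (n * ((c + 2) * (n + 1) + 1) + 1)
      (.loop (.lt 11 0) (seqs [.instr (.const 13 0), .loop (.lt 13 8) scanEdgeProgram,
        .instr (.add 11 11 4)])) s (I n) := by
    intro s hs
    refine Runs.loop hbody (fun s hs => ?_) hs
    obtain ⟨hsr, m, e, par, hG, -⟩ := hs
    simp [Test.Holds, hsr, hG.reg_n]
  have hinit : Runs W 5 (seqs [.instr (.const 4 1), .instr (.sub 8 0 4), .instr (.store 2 2 4),
      .instr (.const 9 1), .instr (.const 11 0)]) (input n l) (I 0) := by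
    refine Runs.of_wp (p := seqs _) ?_
    have h0 : ∀ x, (input n l).reg x = if x = 0 then n else 0 := fun x => rfl
    simp only [seqs, wp, Instr.value, Instr.exec, State.reg_setReg, Nat.reduceEqDiff,
      if_true, if_false, h0]
    have harr : ∀ a i, 2 ≤ a → (input n l).arr a i = 0 := by
      intro a i ha
      have h1 : a ≠ 0 := by omega
      have h2 : a ≠ 1 := by omega
      simp only [input, h1, h2, if_false]
      cases l[i]? <;> rfl
    refine ⟨by omega, by omega, by omega, by omega, by omega, by simp, 1,
      fun _ => ⟨0, hn⟩, fun _ => 0, ⟨⟨by intros; omega, by intros; omega, by intros; omega⟩,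
        one_pos, ?_, ?_, ?_, ?_, ?_, ?_, ?_, ?_, ?_, ?_, ?_⟩, by simp⟩
    · simp [h0]
    · simp [h0]
    · simp
    · simp
    · simp
    · simp
    · simp
    · intro k hk
      obtain rfl : k = 0 := by omega
      simp
    · intro v hv
      have : (v : ℕ) ≠ 0 := fun h => hv 0 one_pos (Fin.ext h.symm)
      simp [this, harr]
    · intros; omega
    · intro a ha i
      have h2 : a ≠ 2 := by omega
      simp [h2, harr a i (by omega)]
  refine (hinit.seq hloop).mono ?_ ?_
  · nlinarith
  · rintro s ⟨-, m, e, par, hG, hm⟩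
    obtain rfl : m = n := le_antisymm hG.le (by omega)
    exact ⟨e, par, hG⟩

end RAM

/-! ### Deciding the existence of a colouring with given degrees -/

namespace RAM

open SimpleGraph Finset

variable {c n W : ℕ} {par : ℕ → ℕ} {b : Fin c → ℕ} {h : Finset (Fin c) → ℕ} {s : State}

/-- The array in which the numbers `childCount` for the set `A` of colours are kept. -/
def tableArray (A : Finset (Fin c)) : ℕ := 5 + Encodable.encode A

@[simp] theorem tableArray_inj {A B : Finset (Fin c)} : tableArray A = tableArray B ↔ A = B := by
  simp [tableArray]

/-- The register that holds `0`, `1` or `b i`, as the choice `δ` requires. -/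
def degreeReg (δ : Fin c → Fin 3) (i : Fin c) : ℕ :=
  if δ i = 0 then 2 else if δ i = 1 then 4 else 20 + 2 * i

/-- Compute the two sides of Hall's condition for the set `A` of colours, at the vertex in
register `1`. -/
noncomputable def hallProgram (p : Option (Fin c)) (δ : Fin c → Fin 3) (A : Finset (Fin c)) :
    Program :=
  seqs [.instr (.load 5 (tableArray A) 1), .instr (.const 7 0),
    forEach A fun i => seqs [.instr (.add 7 7 (degreeReg δ i)),
      if p = some i then .instr (.add 5 5 4) else .skip]]

/-- Set register `9` to a nonzero number if the choice `δ` of degrees violates one of the conditions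
of `CanExtend`. -/
noncomputable def choiceProgram (p : Option (Fin c)) (δ : Fin c → Fin 3) : Program :=
  seqs [.instr (.const 9 0),
    forEach univ fun A => seqs [hallProgram p δ A, .ite (.lt 7 5) (.instr (.const 9 1)) .skip],
    hallProgram p δ univ, .ite (.lt 5 7) (.instr (.const 9 1)) .skip]

/-- Set register `11` to a nonzero number if and only if `CanExtend` holds at the vertex in
register `1`. -/
noncomputable def extendProgram (p : Option (Fin c)) : Program :=
  seqs [.instr (.const 11 0),
    forEach univ fun δ => seqs [choiceProgram p δ, .ite (.eq 9 2) (.instr (.const 11 1)) .skip]]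

/-- The input of `extendProgram`: registers `20 + 2 * i` hold the numbers `b i`, and the table holds
the numbers `h A` for the vertex in register `1`. -/
structure ExtendReady (n : ℕ) (b : Fin c → ℕ) (h : Finset (Fin c) → ℕ) (s : State) : Prop where
  reg_zero : s.reg 2 = 0
  reg_one : s.reg 4 = 1
  reg_b : ∀ i : Fin c, s.reg (20 + 2 * i) = b i
  b_le : ∀ i, b i ≤ n
  table : ∀ A, s.arr (tableArray A) (s.reg 1) = h A
  h_le : ∀ A, h A ≤ n

/-- `s` and `s'` differ only in the registers that `extendProgram` uses. -/
def SameExtend (s s' : State) : Prop :=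
  s'.arr = s.arr ∧ ∀ x, x ≠ 5 → x ≠ 7 → x ≠ 9 → x ≠ 11 → s'.reg x = s.reg x

theorem SameExtend.trans {s₁ s₂ s₃ : State} (h₁ : SameExtend s₁ s₂) (h₂ : SameExtend s₂ s₃) :
    SameExtend s₁ s₃ :=
  ⟨h₂.1.trans h₁.1, fun x h5 h7 h9 h11 => (h₂.2 x h5 h7 h9 h11).trans (h₁.2 x h5 h7 h9 h11)⟩

theorem ExtendReady.congr (hs : ExtendReady n b h s) {s' : State} (hss : SameExtend s s') :
    ExtendReady n b h s' := by
  obtain ⟨h1, h2, h3, h4, h5, h6⟩ := hs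
  obtain ⟨ha, hr⟩ := hss
  refine ⟨?_, ?_, fun i => ?_, h4, fun A => ?_, h6⟩
  · rw [hr 2 (by omega) (by omega) (by omega) (by omega), h1]
  · rw [hr 4 (by omega) (by omega) (by omega) (by omega), h2]
  · rw [hr _ (by omega) (by omega) (by omega) (by omega), h3]
  · rw [hr 1 (by omega) (by omega) (by omega) (by omega), ha, h5]

theorem ExtendReady.reg_degreeReg (hs : ExtendReady n b h s) (δ : Fin c → Fin 3) (i : Fin c) :
    s.reg (degreeReg δ i) = chosenDegree b δ i := by
  unfold degreeReg chosenDegree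
  split_ifs
  · exact hs.reg_zero
  · exact hs.reg_one
  · exact hs.reg_b i

theorem ExtendReady.sum_chosenDegree_le (hs : ExtendReady n b h s) (δ : Fin c → Fin 3)
    (A : Finset (Fin c)) : ∑ i ∈ A, chosenDegree b δ i ≤ c * (n + 1) := by
  calc ∑ i ∈ A, chosenDegree b δ i ≤ ∑ _i ∈ A, (n + 1) := sum_le_sum fun i _ => by
        have := hs.b_le i
        have := chosenDegree_eq_or b δ i
        omega
    _ = #A * (n + 1) := by simp
    _ ≤ c * (n + 1) := Nat.mul_le_mul_right _ (by simpa using card_le_univ A)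

theorem sum_ite_some_le (p : Option (Fin c)) (A : Finset (Fin c)) :
    (∑ i ∈ A, if p = some i then 1 else 0) ≤ 1 := by
  rcases p with _ | j
  · simp
  · simp only [Option.some.injEq, sum_ite_eq]
    split_ifs <;> simp

theorem ExtendReady.wp_hall (hs : ExtendReady n b h s) (hW : (c + 2) * (n + 1) ≤ W)
    (p : Option (Fin c)) (δ : Fin c → Fin 3) (A : Finset (Fin c)) :
    wp W (hallProgram p δ A) (fun s' => s'.arr = s.arr ∧
      (∀ x, x ≠ 5 → x ≠ 7 → s'.reg x = s.reg x) ∧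
      s'.reg 5 = h A + (∑ i ∈ A, if p = some i then 1 else 0) ∧
      s'.reg 7 = ∑ i ∈ A, chosenDegree b δ i) s := by
  have hbound : c * (n + 1) + 2 * (n + 1) ≤ W := by rwa [← Nat.add_mul]
  have hA := hs.h_le A
  simp only [hallProgram, seqs, wp, Instr.value, Instr.exec, hs.table]
  refine ⟨by omega, by omega, ?_⟩
  refine wp_forEach (I := fun D s' => s'.arr = s.arr ∧
    (∀ x, x ≠ 5 → x ≠ 7 → s'.reg x = s.reg x) ∧
    s'.reg 5 = h A + (∑ i ∈ D, if p = some i then 1 else 0) ∧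
    s'.reg 7 = ∑ i ∈ D, chosenDegree b δ i) ?_ ?_
  · rintro D i hi hiD s' ⟨ha, hr, h5, h7⟩
    have hs' : ExtendReady n b h s' :=
      hs.congr ⟨ha, fun x h5 h7 _ _ => hr x h5 h7⟩
    have hb1 := hs.sum_chosenDegree_le δ (insert i D)
    have hb2 := sum_ite_some_le p (insert i D)
    rw [sum_insert hiD] at hb1 hb2
    simp only [sum_insert hiD, wp, Instr.value, Instr.exec, h7, hs'.reg_degreeReg]
    refine ⟨by omega, ?_⟩
    by_cases hpi : p = some i
    · simp only [hpi, if_true, wp, Instr.value, Instr.exec, State.reg_setReg, Nat.reduceEqDiff,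
        if_false, h5, hs'.reg_one] at hb2 ⊢
      refine ⟨by omega, by simpa using ha, fun x hx5 hx7 => by simp [hx5, hx7, hr], by omega,
        by omega⟩
    · simp only [hpi, if_false, wp]
      exact ⟨by simpa using ha, fun x hx5 hx7 => by simp [hx7, hr x hx5 hx7], by simp [h5],
        by simp [Nat.add_comm]⟩
  · exact ⟨by simp, fun x h5 h7 => by simp [h5, h7], by simp, by simp⟩

theorem ExtendReady.wp_choice (hs : ExtendReady n b h s) (hW : (c + 2) * (n + 1) ≤ W)
    (p : Option (Fin c)) (δ : Fin c → Fin 3) :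
    wp W (choiceProgram p δ) (fun s' => SameExtend s s' ∧ s'.reg 11 = s.reg 11 ∧
      (s'.reg 9 = 0 ↔
        (∀ A, h A + (∑ i ∈ A, if p = some i then 1 else 0) ≤ ∑ i ∈ A, chosenDegree b δ i) ∧
          ∑ i, chosenDegree b δ i ≤ h univ + ∑ i, if p = some i then 1 else 0)) s := by
  have hW1 : 1 ≤ W := le_trans (by nlinarith) hW
  simp only [choiceProgram, seqs, wp, Instr.value, Instr.exec]
  refine ⟨by omega, ?_⟩
  refine wp_mono (fun s₁ hs₁ => ?_) (wp_forEach (I := fun D s' => SameExtend s s' ∧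
    s'.reg 11 = s.reg 11 ∧ (s'.reg 9 = 0 ↔ ∀ A ∈ D,
      h A + (∑ i ∈ A, if p = some i then 1 else 0) ≤ ∑ i ∈ A, chosenDegree b δ i)) ?_ ?_)
  · obtain ⟨hs₁, h11, h9⟩ := hs₁
    refine wp_mono ?_ ((hs.congr hs₁).wp_hall hW p δ univ)
    rintro s₂ ⟨ha, hr, h5, h7⟩
    simp only [mem_univ, true_imp_iff] at h9
    rw [← h9, ← hr 9 (by omega) (by omega)]
    have hs₂ := hs₁.trans ⟨ha, fun x h5 h7 _ _ => hr x h5 h7⟩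
    have h11' : s₂.reg 11 = s.reg 11 := by rw [hr 11 (by omega) (by omega), h11]
    simp only [Test.Holds, h5, h7]
    refine ⟨fun hlt => ⟨hW1, ⟨by simpa using hs₂.1, fun x h5 h7 h9 h11 => ?_⟩, by simpa using h11',
      ?_⟩, fun hlt => ⟨hs₂, h11', ?_⟩⟩
    · simp [h9, hs₂.2 x h5 h7 h9 h11]
    · simp only [State.reg_setReg, if_true]
      omega
    · omega
  · rintro D A - hAD s₁ ⟨hs₁, h11, h9⟩
    simp only [wp, Instr.value, Instr.exec]
    refine wp_mono ?_ ((hs.congr hs₁).wp_hall hW p δ A)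
    rintro s₂ ⟨ha, hr, h5, h7⟩
    rw [forall_mem_insert, ← h9, ← hr 9 (by omega) (by omega)]
    have hs₂ := hs₁.trans ⟨ha, fun x h5 h7 _ _ => hr x h5 h7⟩
    have h11' : s₂.reg 11 = s.reg 11 := by rw [hr 11 (by omega) (by omega), h11]
    simp only [Test.Holds, h5, h7]
    refine ⟨fun hlt => ⟨hW1, ⟨by simpa using hs₂.1, fun x h5 h7 h9 h11 => ?_⟩, by simpa using h11',
      ?_⟩, fun hlt => ⟨hs₂, h11', ?_⟩⟩
    · simp [h9, hs₂.2 x h5 h7 h9 h11]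
    · simp only [State.reg_setReg, if_true]
      omega
    · omega
  · refine ⟨⟨by simp, fun x _ _ h9 _ => by simp [h9]⟩, by simp, by simp⟩

theorem ExtendReady.wp_extend (hs : ExtendReady n b h s) (hW : (c + 2) * (n + 1) ≤ W)
    (p : Option (Fin c)) :
    wp W (extendProgram p) (fun s' => SameExtend s s' ∧ s'.reg 11 ≤ 1 ∧
      (s'.reg 11 ≠ 0 ↔ CanExtend b h p)) s := by
  have hW1 : 1 ≤ W := le_trans (by nlinarith) hW
  simp only [extendProgram, seqs, wp, Instr.value, Instr.exec]
  refine ⟨by omega, ?_⟩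
  refine wp_mono (fun s₁ hs₁ => ?_) (wp_forEach (I := fun D s' => SameExtend s s' ∧
    s'.reg 11 ≤ 1 ∧ (s'.reg 11 ≠ 0 ↔ ∃ δ ∈ D,
      (∀ A, h A + (∑ i ∈ A, if p = some i then 1 else 0) ≤ ∑ i ∈ A, chosenDegree b δ i) ∧
        ∑ i, chosenDegree b δ i ≤ h univ + ∑ i, if p = some i then 1 else 0)) ?_ ?_)
  · simpa [CanExtend] using hs₁
  · rintro D δ - hδD s₁ ⟨hs₁, hle, h11⟩
    simp only [wp, Instr.value, Instr.exec]
    refine wp_mono ?_ ((hs.congr hs₁).wp_choice hW p δ)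
    rintro s₂ ⟨hs₂, h11', h9⟩
    have hs₃ := hs₁.trans hs₂
    rw [← h11'] at hle
    simp only [exists_mem_insert, ← h11, ← h9, ← h11', Test.Holds,
      ((hs.congr hs₃).reg_zero)]
    refine ⟨fun h0 => ⟨hW1, ⟨by simpa using hs₃.1, fun x h5 h7 h9 h11 => ?_⟩,
      by simp, ?_⟩, fun h0 => ⟨hs₃, hle, ?_⟩⟩
    · simp [h11, hs₃.2 x h5 h7 h9 h11]
    · simp [h0]
    · simp [h0]
  · refine ⟨⟨by simp, fun x _ _ _ h11 => by simp [h11]⟩, by simp, by simp⟩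

/-- Account for the vertex in register `1`, with parent in register `13` and list of colours in the
registers `21 + 2 * i`, in the table for the set `A`, and reset the entry of the vertex itself. -/
noncomputable def tableProgram (A : Finset (Fin c)) : Program :=
  seqs [.instr (.const 15 0),
    forEach Aᶜ fun i => .ite (.ne (21 + 2 * i) 2) (.instr (.const 15 1)) .skip,
    .instr (.load 17 (tableArray A) 13),
    .ite (.eq 15 2) (.instr (.add 17 17 4)) .skip,
    .instr (.store (tableArray A) 13 17), .instr (.store (tableArray A) 1 2)]

/-- Treat the vertex before the one in register `1`. -/
noncomputable def nodeProgram (c : ℕ) : Program :=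
  seqs [.instr (.sub 1 1 4),
    forEach univ fun p : Fin c => seqs [extendProgram (some p), .instr (.copy (21 + 2 * p) 11)],
    .instr (.load 13 3 1),
    forEach univ fun A : Finset (Fin c) => tableProgram A]

/-- Set register `3` to `1` if there is a colouring with the degrees `b i` in the registers
`20 + 2 * i`. The table is zero before and after. -/
noncomputable def colorProgram (c : ℕ) : Program :=
  seqs [.instr (.copy 1 0), .loop (.lt 4 1) (nodeProgram c), .instr (.const 1 0),
    extendProgram (none : Option (Fin c)), .ite (.ne 11 2) (.instr (.const 3 1)) .skip,
    forEach univ fun A : Finset (Fin c) => .instr (.store (tableArray A) 1 2)]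

theorem wp_table {j k : ℕ} {X : Finset (Fin c)} (A : Finset (Fin c)) (h0 : s.reg 2 = 0)
    (h1 : s.reg 4 = 1) (hk : s.reg 1 = k) (hj : s.reg 13 = j) (hjk : j ≠ k)
    (hX : ∀ i : Fin c, s.reg (21 + 2 * i) ≠ 0 ↔ i ∈ X) (hW : s.arr (tableArray A) j + 1 ≤ W) :
    wp W (tableProgram A) (fun s' => (∀ x, x ≠ 15 → x ≠ 17 → s'.reg x = s.reg x) ∧
      (∀ a, a ≠ tableArray A → s'.arr a = s.arr a) ∧
      ∀ y, s'.arr (tableArray A) y = if y = k then 0 else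
        s.arr (tableArray A) y + if j = y ∧ X ⊆ A then 1 else 0) s := by
  simp only [tableProgram, seqs, wp, Instr.value, Instr.exec]
  refine ⟨by omega, ?_⟩
  refine wp_mono (fun s₁ hs₁ => ?_) (wp_forEach (I := fun D s' => s'.arr = s.arr ∧
    (∀ x, x ≠ 15 → s'.reg x = s.reg x) ∧ (s'.reg 15 = 0 ↔ ∀ i ∈ D, i ∉ X)) ?_ ?_)
  · obtain ⟨ha, hr, h15⟩ := hs₁
    have hsub : (∀ i ∈ Aᶜ, i ∉ X) ↔ X ⊆ A := by
      simp only [mem_compl, subset_iff]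
      exact forall_congr' fun i => not_imp_not
    rw [hsub] at h15
    have hr1 : s₁.reg 1 = k := by rw [hr 1 (by omega), hk]
    have hr2 : s₁.reg 2 = 0 := by rw [hr 2 (by omega), h0]
    have hr4 : s₁.reg 4 = 1 := by rw [hr 4 (by omega), h1]
    have hr13 : s₁.reg 13 = j := by rw [hr 13 (by omega), hj]
    simp only [Test.Holds, State.reg_setReg, State.reg_setArr, Nat.reduceEqDiff, if_true,
      if_false, hr1, hr2, hr4, hr13, ha, h15]
    refine ⟨by omega, fun hXA => ⟨hW, hW, by omega, fun x hx15 hx17 => ?_, fun a hA => ?_,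
      fun y => ?_⟩, fun hXA => ⟨by omega, by omega, fun x hx15 hx17 => ?_, fun a hA => ?_,
      fun y => ?_⟩⟩
    · simp [hx17, hr x hx15]
    · ext i
      simp [hA, ha]
    · by_cases hyk : y = k
      · simp [hyk]
      · by_cases hyj : y = j
        · simp [hyj, hjk, hXA]
        · simp [hyk, hyj, Ne.symm hyj, ha]
    · simp [hx17, hr x hx15]
    · ext i
      simp [hA, ha]
    · by_cases hyk : y = k
      · simp [hyk]
      · by_cases hyj : y = j
        · simp [hyj, hjk, hXA]
        · simp [hyk, hyj, hXA, ha]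
  · rintro D i - hiD s' ⟨ha, hr, h15⟩
    simp only [wp, Instr.value, Instr.exec, Test.Holds]
    rw [hr 2 (by omega), h0, hr (21 + 2 * i) (by omega), hX, forall_mem_insert, ← h15]
    refine ⟨fun hi => ⟨by omega, by simpa using ha, fun x hx => ?_, ?_⟩, fun hi => ⟨ha, hr, ?_⟩⟩
    · simp [hx, hr x hx]
    · simp [hi]
    · simp [hi]
  · exact ⟨by simp, fun x hx => by simp [hx], by simp⟩

theorem childCount_le {lo : ℕ} {S : ℕ → Finset (Fin c)} {j : ℕ} {A : Finset (Fin c)} :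
    childCount lo n par S j A ≤ n - lo :=
  (card_filter_le _ _).trans (by simp)

theorem childCount_congr (hpar : ∀ k, 0 < k → k < n → par k < k) {S S' : ℕ → Finset (Fin c)}
    {lo lo' j : ℕ} (hlo : 0 < lo) (hlo' : 0 < lo') (hj : lo ≤ j + 1) (hj' : lo' ≤ j + 1)
    (hS : ∀ k, j < k → S k = S' k) : childCount lo n par S j = childCount lo' n par S' j := by
  ext A
  unfold childCount
  congr 1
  ext k
  simp only [mem_filter, mem_Ico]
  constructor
  · rintro ⟨⟨hk, hkn⟩, rfl, hA⟩
    have := hpar k (by omega) hkn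
    exact ⟨⟨by omega, hkn⟩, rfl, by rwa [← hS k this]⟩
  · rintro ⟨⟨hk, hkn⟩, rfl, hA⟩
    have := hpar k (by omega) hkn
    exact ⟨⟨by omega, hkn⟩, rfl, by rwa [hS k this]⟩

theorem childCount_update {S : ℕ → Finset (Fin c)} {k : ℕ} {X : Finset (Fin c)} (hk : k < n)
    (j : ℕ) (A : Finset (Fin c)) :
    childCount k n par (Function.update S k X) j A =
      childCount (k + 1) n par S j A + if par k = j ∧ X ⊆ A then 1 else 0 := by
  have h1 : ({l ∈ Ico (k + 1) n | par l = j ∧ Function.update S k X l ⊆ A} : Finset ℕ) =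
      {l ∈ Ico (k + 1) n | par l = j ∧ S l ⊆ A} := by
    refine filter_congr fun l hl => ?_
    rw [mem_Ico] at hl
    rw [Function.update_of_ne (by omega)]
  unfold childCount
  rw [← Finset.insert_Ico_add_one_left_eq_Ico hk, filter_insert, Function.update_self, h1]
  split_ifs
  · rw [card_insert_of_notMem (by simp)]
  · rfl

/-- The numbers that `colorProgram` uses but does not change. -/
structure ColorReady (n : ℕ) (par : ℕ → ℕ) (b : Fin c → ℕ) (s : State) : Prop where
  reg_n : s.reg 0 = n
  reg_zero : s.reg 2 = 0
  reg_one : s.reg 4 = 1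
  reg_b : ∀ i : Fin c, s.reg (20 + 2 * i) = b i
  b_le : ∀ i, b i ≤ n
  arr_par : ∀ k, 0 < k → k < n → s.arr 3 k = par k

/-- `s` and `s'` differ only in the table and in registers with odd numbers. -/
def SameColor (c : ℕ) (s s' : State) : Prop :=
  (∀ x, x % 2 = 0 → s'.reg x = s.reg x) ∧ s'.reg 3 = s.reg 3 ∧
    ∀ a, (∀ A : Finset (Fin c), a ≠ tableArray A) → s'.arr a = s.arr a

theorem three_ne_tableArray (A : Finset (Fin c)) : 3 ≠ tableArray A := by
  unfold tableArray
  omega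

theorem ColorReady.congr (hs : ColorReady n par b s) {s' : State} (hss : SameColor c s s') :
    ColorReady n par b s' := by
  obtain ⟨h1, h2, h3, h4, h5, h6⟩ := hs
  obtain ⟨hr, -, ha⟩ := hss
  refine ⟨?_, ?_, ?_, fun i => ?_, h5, fun k hk hkn => ?_⟩
  · rw [hr 0 (by omega), h1]
  · rw [hr 2 (by omega), h2]
  · rw [hr 4 (by omega), h3]
  · rw [hr _ (by omega), h4]
  · rw [ha 3 three_ne_tableArray, h6 k hk hkn]

/-- The invariant of the main loop of `colorProgram`, started in `s₀`: the vertices from `lo` on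
have been treated. -/
def Coloring (n : ℕ) (par : ℕ → ℕ) (b : Fin c → ℕ) (s₀ : State) (lo : ℕ) (s : State) : Prop :=
  SameColor c s₀ s ∧ s.reg 1 = lo ∧ ∃ S : ℕ → Finset (Fin c), IsColorTable lo n par b S ∧
    ∀ A j, s.arr (tableArray A) j = if j < lo then childCount lo n par S j A else 0

theorem Coloring.wp_node {s₀ : State} {lo : ℕ} (h₀ : ColorReady n par b s₀)
    (hpar : ∀ k, 0 < k → k < n → par k < k) (h : Coloring n par b s₀ (lo + 1) s)
    (hW : (c + 2) * (n + 1) ≤ W) (hlo : 0 < lo) (hlon : lo < n) :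
    wp W (nodeProgram c) (Coloring n par b s₀ lo) s := by
  classical
  obtain ⟨hss, hr1, S, hS, htab⟩ := h
  have hs := h₀.congr hss
  have hWn : n + 1 ≤ W := le_trans (by nlinarith) hW
  let X : Finset (Fin c) := {p | CanExtend b (childCount 1 n par S lo) (some p)}
  simp only [nodeProgram, seqs, wp, Instr.value, Instr.exec, hr1, hs.reg_one]
  refine ⟨by omega, ?_⟩
  rw [Nat.add_sub_cancel]
  have hE : ExtendReady n b (childCount 1 n par S lo) (s.setReg 1 lo) := by
    refine ⟨by simpa using hs.reg_zero, by simpa using hs.reg_one, fun i => ?_, hs.b_le,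
      fun A => ?_, fun A => childCount_le.trans (by omega)⟩
    · have : 20 + 2 * (i : ℕ) ≠ 1 := by omega
      simp [this, hs.reg_b]
    · simp [htab, childCount_congr hpar (Nat.succ_pos lo) one_pos le_rfl (by omega) fun _ _ => rfl]
  refine wp_mono (fun s₁ hs₁ => ?_) (wp_forEach (I := fun D s' => s'.arr = s.arr ∧
    (∀ x, x ≠ 5 → x ≠ 7 → x ≠ 9 → x ≠ 11 → (x % 2 = 0 ∨ x < 20) →
      s'.reg x = (s.setReg 1 lo).reg x) ∧
    ∀ p : Fin c, p ∈ D → (s'.reg (21 + 2 * p) ≠ 0 ↔ p ∈ X)) ?_ ?_)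
  · obtain ⟨ha, hr, hX⟩ := hs₁
    have hr1 : s₁.reg 1 = lo := by
      rw [hr 1 (by omega) (by omega) (by omega) (by omega) (by omega)]
      simp
    have hreven : ∀ x, x % 2 = 0 → s₁.reg x = s.reg x := by
      intro x hx
      rw [hr x (by omega) (by omega) (by omega) (by omega) (by omega)]
      have : x ≠ 1 := by omega
      simp [this]
    have hr3 : s₁.reg 3 = s.reg 3 := by
      rw [hr 3 (by omega) (by omega) (by omega) (by omega) (by omega)]
      simp
    have hpl := hpar lo hlo hlon
    rw [hr1, ha, hs.arr_par lo hlo hlon]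
    refine ⟨by omega, ?_⟩
    -- The table entries for the sets in `D` have been updated.
    refine wp_mono (fun s₂ hs₂ => ?_) (wp_forEach (I := fun D s' =>
      (∀ x, x ≠ 15 → x ≠ 17 → s'.reg x = (s₁.setReg 13 (par lo)).reg x) ∧
      (∀ a, (∀ A : Finset (Fin c), a ≠ tableArray A) → s'.arr a = s.arr a) ∧
      ∀ (A : Finset (Fin c)) y, s'.arr (tableArray A) y =
        if A ∈ D then
          if y = lo then 0 else s.arr (tableArray A) y + if par lo = y ∧ X ⊆ A then 1 else 0
        else s.arr (tableArray A) y) ?_ ?_)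
    · obtain ⟨hr', ha', htab'⟩ := hs₂
      refine ⟨⟨fun x hx => ?_, ?_, fun a hA => ?_⟩, ?_, Function.update S lo X,
        fun k hk hkn p => ?_, fun A j => ?_⟩
      · have h13 : x ≠ 13 := by omega
        rw [hr' x (by omega) (by omega), State.reg_setReg, if_neg h13, hreven x hx, hss.1 x hx]
      · rw [hr' 3 (by omega) (by omega)]
        simp [hr3, hss.2.1]
      · rw [ha' a hA, hss.2.2 a hA]
      · rw [hr' 1 (by omega) (by omega)]
        simp [hr1]
      · have hcc : childCount 1 n par (Function.update S lo X) k = childCount 1 n par S k :=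
          childCount_congr hpar one_pos one_pos (by omega) (by omega) fun l hl =>
            Function.update_of_ne (by omega) _ _
        rw [hcc]
        rcases Nat.eq_or_lt_of_le hk with rfl | hk
        · rw [Function.update_self]
          simp [X]
        · rw [Function.update_of_ne hk.ne', hS k hk hkn]
      · rw [htab', if_pos (mem_univ A), htab, childCount_update hlon]
        by_cases hj : j = lo
        · simp [hj]
        · have h1 : j < lo + 1 ↔ j < lo := by omega
          simp only [hj, if_false, h1]
          by_cases hjl : j < lo
          · simp [hjl]
          · have : par lo ≠ j := by omega
            simp [hjl, this]
    · rintro D A - hAD s' ⟨hr', ha', htab'⟩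
      have e1 : s'.reg 1 = lo := by
        rw [hr' 1 (by omega) (by omega)]
        simp [hr1]
      have e2 : s'.reg 2 = 0 := by
        rw [hr' 2 (by omega) (by omega)]
        simp [hreven, hs.reg_zero]
      have e4 : s'.reg 4 = 1 := by
        rw [hr' 4 (by omega) (by omega)]
        simp [hreven, hs.reg_one]
      have e13 : s'.reg 13 = par lo := by
        rw [hr' 13 (by omega) (by omega)]
        simp
      have eX : ∀ i : Fin c, s'.reg (21 + 2 * i) ≠ 0 ↔ i ∈ X := by
        intro i
        have h13 : 21 + 2 * (i : ℕ) ≠ 13 := by omega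
        rw [hr' _ (by omega) (by omega), State.reg_setReg, if_neg h13, hX i (mem_univ i)]
      have eA : s'.arr (tableArray A) (par lo) + 1 ≤ W := by
        rw [htab', if_neg hAD, htab, if_pos (by omega)]
        have := childCount_le (lo := lo + 1) (n := n) (par := par) (S := S) (j := par lo) (A := A)
        omega
      refine wp_mono ?_ (wp_table A e2 e4 e1 e13 hpl.ne eX eA)
      rintro s'' ⟨hr'', ha'', htab''⟩
      refine ⟨fun x h15 h17 => (hr'' x h15 h17).trans (hr' x h15 h17),
        fun a hA => (ha'' a (hA A)).trans (ha' a hA), fun B y => ?_⟩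
      by_cases hBA : B = A
      · subst hBA
        rw [htab'', htab', if_neg hAD, if_pos (mem_insert_self _ _)]
      · rw [ha'' _ (by simpa using hBA), htab']
        simp [hBA]
    · exact ⟨fun x _ _ => rfl, fun a _ => by simp [ha], fun A y => by simp [ha]⟩
  · rintro D p - hpD s' ⟨ha, hr, hX⟩
    have hE' : ExtendReady n b (childCount 1 n par S lo) s' := by
      obtain ⟨h1, h2, h3, h4, h5, h6⟩ := hE
      refine ⟨?_, ?_, fun i => ?_, h4, fun A => ?_, h6⟩
      · rw [hr _ (by omega) (by omega) (by omega) (by omega) (by omega), h1]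
      · rw [hr _ (by omega) (by omega) (by omega) (by omega) (by omega), h2]
      · rw [hr _ (by omega) (by omega) (by omega) (by omega) (by omega), h3]
      · rw [hr _ (by omega) (by omega) (by omega) (by omega) (by omega), ha]
        exact h5 A
    refine wp_mono (p := extendProgram (some p)) ?_ (hE'.wp_extend hW (some p))
    rintro s'' ⟨⟨ha', hr'⟩, hle, h11⟩
    simp only [wp, Instr.value, Instr.exec]
    refine ⟨by omega, by simp [ha', ha], fun x h5 h7 h9 h11 hx => ?_, fun q hq => ?_⟩
    · have : x ≠ 21 + 2 * p := by omega
      rw [State.reg_setReg, if_neg this, hr' x h5 h7 h9 h11, hr x h5 h7 h9 h11 hx]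
    · by_cases hqp : q = p
      · subst hqp
        simpa [X] using h11
      · have : 21 + 2 * (q : ℕ) ≠ 21 + 2 * p := fun h => hqp (Fin.ext (by omega))
        rw [State.reg_setReg, if_neg this,
          hr' _ (by omega) (by omega) (by omega) (by omega)]
        exact hX q (mem_of_mem_insert_of_ne hq hqp)
  · exact ⟨rfl, fun x _ _ _ _ _ => rfl, by simp⟩

theorem runs_colorProgram (c : ℕ) [NeZero c] : ∃ K, ∀ (n W : ℕ) (par : ℕ → ℕ) (b : Fin c → ℕ)
    (s : State), 0 < n → (∀ k, 0 < k → k < n → par k < k) → (c + 2) * (n + 1) ≤ W →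
      ColorReady n par b s → (∀ (A : Finset (Fin c)) j, s.arr (tableArray A) j = 0) →
      Runs W (K * (n + 1)) (colorProgram c) s (fun s' => s'.arr = s.arr ∧
        (∀ x, x % 2 = 0 → s'.reg x = s.reg x) ∧
        (s'.reg 3 ≠ 0 ↔ s.reg 3 ≠ 0 ∨ HasColoring n par b)) := by
  have hc : 0 < c := NeZero.pos c
  let last : Program := seqs [.instr (.const 1 0), extendProgram (none : Option (Fin c)),
    .ite (.ne 11 2) (.instr (.const 3 1)) .skip,
    forEach univ fun A : Finset (Fin c) => .instr (.store (tableArray A) 1 2)]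
  refine ⟨(nodeProgram c).cost + last.cost + 3, fun n W par b s hn hpar hW hs htab => ?_⟩
  have hWn : n + 1 ≤ W := le_trans (by nlinarith) hW
  have hfirst : Runs W 1 (.instr (.copy 1 0)) s (Coloring n par b s n) := by
    refine Runs.of_wp (p := .instr _) ?_
    simp only [wp, Instr.value, Instr.exec, hs.reg_n]
    refine ⟨by omega, ⟨fun x hx => ?_, by simp, by simp⟩, by simp, fun _ => ∅,
      by intro k hk hkn; omega, fun A j => ?_⟩
    · have : x ≠ 1 := by omega
      simp [this]
    · simp [htab, childCount]
  have hloop : ∀ s', Coloring n par b s n s' →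
      Runs W ((n - 1) * ((nodeProgram c).cost + 1) + 1) (.loop (.lt 4 1) (nodeProgram c)) s'
        (Coloring n par b s 1) := by
    intro s' hs'
    refine (Runs.loop (N := n - 1) (I := fun i => Coloring n par b s (n - i))
      (fun i hi s' hs' => ⟨?_, Runs.of_wp ?_⟩) (fun s' hs' => ?_) hs').mono le_rfl fun s' hs' => ?_
    · simp only [Test.Holds, hs'.2.1, (hs.congr hs'.1).reg_one]
      omega
    · refine Coloring.wp_node hs hpar ?_ hW (by omega) (by omega)
      rwa [show n - (i + 1) + 1 = n - i by omega]
    · simp only [Test.Holds, hs'.2.1, (hs.congr hs'.1).reg_one]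
      omega
    · rwa [show n - (n - 1) = 1 by omega] at hs'
  have hlast : ∀ s', Coloring n par b s 1 s' → Runs W last.cost last s' (fun s' =>
      s'.arr = s.arr ∧ (∀ x, x % 2 = 0 → s'.reg x = s.reg x) ∧
        (s'.reg 3 ≠ 0 ↔ s.reg 3 ≠ 0 ∨ HasColoring n par b)) := by
    rintro s₁ ⟨hss, hr1, S, hS, htab'⟩
    have hs₁ := hs.congr hss
    refine Runs.of_wp ?_
    simp only [last, seqs, wp, Instr.value, Instr.exec]
    refine ⟨by omega, ?_⟩
    have hE : ExtendReady n b (childCount 1 n par S 0) (s₁.setReg 1 0) := by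
      refine ⟨by simpa using hs₁.reg_zero, by simpa using hs₁.reg_one, fun i => ?_, hs₁.b_le,
        fun A => ?_, fun A => childCount_le.trans (by omega)⟩
      · have : 20 + 2 * (i : ℕ) ≠ 1 := by omega
        simp [this, hs₁.reg_b]
      · simp [htab']
    refine wp_mono ?_ (hE.wp_extend hW none)
    rintro s₂ ⟨⟨ha, hr⟩, -, h11⟩
    rw [← hS.hasColoring_iff hpar hn] at h11
    have hfin : ∀ s₃ : State, s₃.reg 1 = 0 → s₃.arr = s₁.arr →
        (∀ x, x % 2 = 0 → s₃.reg x = s.reg x) →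
        wp W (forEach univ fun A : Finset (Fin c) => .instr (.store (tableArray A) 1 2))
          (fun s' => s'.arr = s.arr ∧ (∀ x, x % 2 = 0 → s'.reg x = s.reg x) ∧
            s'.reg 3 = s₃.reg 3) s₃ := by
      intro s₃ h1 harr hreg
      have h2 : s₃.reg 2 = 0 := by rw [hreg 2 (by omega), hs.reg_zero]
      refine wp_mono ?_ (wp_forEach (I := fun D s' => s'.reg = s₃.reg ∧
        (∀ a, (∀ A : Finset (Fin c), a ≠ tableArray A) → s'.arr a = s.arr a) ∧
        ∀ A y, s'.arr (tableArray A) y = if A ∈ D then 0 else s₁.arr (tableArray A) y) ?_ ?_)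
      · rintro s' ⟨hr', ha', htab''⟩
        refine ⟨?_, fun x hx => by rw [hr', hreg x hx], by rw [hr']⟩
        ext a y
        by_cases haA : ∃ A : Finset (Fin c), a = tableArray A
        · obtain ⟨A, rfl⟩ := haA
          rw [htab'', if_pos (mem_univ A), htab]
        · push Not at haA
          rw [ha' a haA]
      · rintro D A - hAD s' ⟨hr', ha', htab''⟩
        simp only [wp, Instr.value, Instr.exec, hr', h1, h2]
        refine ⟨by omega, by simp [hr'], fun a hA => ?_, fun B y => ?_⟩
        · ext y
          simp [hA A, ha' a hA]
        · by_cases hBA : B = A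
          · subst hBA
            by_cases hy : y = 0
            · simp [hy]
            · simp [hy, htab'']
              intro
              rw [htab']
              simp [hy]
          · simp [hBA, htab'']
      · exact ⟨rfl, fun a hA => by rw [harr, hss.2.2 a hA], fun A y => by simp [harr]⟩
    have hr3 : s₂.reg 3 = s.reg 3 := by
      rw [hr 3 (by omega) (by omega) (by omega) (by omega)]
      simp [hss.2.1]
    have hreven : ∀ x, x % 2 = 0 → s₂.reg x = s.reg x := by
      intro x hx
      rw [hr x (by omega) (by omega) (by omega) (by omega)]
      have : x ≠ 1 := by omega
      simp [this, hss.1 x hx]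
    have hr1' : s₂.reg 1 = 0 := by
      rw [hr 1 (by omega) (by omega) (by omega) (by omega)]
      simp
    have ha' : s₂.arr = s₁.arr := by simpa using ha
    simp only [Test.Holds, hreven 2 (by omega), hs.reg_zero]
    refine ⟨fun h0 => ⟨by omega, wp_mono ?_ (hfin (s₂.setReg 3 1) (by simp [hr1']) (by simp [ha'])
      fun x hx => ?_)⟩, fun h0 => wp_mono ?_ (hfin s₂ hr1' ha' hreven)⟩
    · rintro s' ⟨h1, h2, h3⟩
      refine ⟨h1, h2, ?_⟩
      rw [h3]
      simpa using Or.inr (h11.1 h0)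
    · have : x ≠ 3 := by omega
      simp [this, hreven x hx]
    · rintro s' ⟨h1, h2, h3⟩
      refine ⟨h1, h2, ?_⟩
      rw [h3, hr3]
      rw [h11] at h0
      simp [h0]
  refine (hfirst.seq fun s' hs' => (hloop s' hs').seq hlast).mono ?_ fun _ h => h
  obtain ⟨k, rfl⟩ : ∃ k, n = k + 1 := ⟨n - 1, by omega⟩
  rw [Nat.add_sub_cancel]
  nlinarith

end RAM

/-! ### Searching for the degrees -/

namespace RAM

open SimpleGraph Finset

variable {c n W : ℕ} {par : ℕ → ℕ} {s : State}

/-- The state between two runs of `colorProgram`: the tree is given by `par` in array `3`, and the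
table is zero. -/
structure Searchable (n : ℕ) (par : ℕ → ℕ) (s : State) : Prop where
  reg_n : s.reg 0 = n
  reg_zero : s.reg 2 = 0
  reg_one : s.reg 4 = 1
  arr_par : ∀ k, 0 < k → k < n → s.arr 3 k = par k
  table : ∀ a, 5 ≤ a → ∀ i, s.arr a i = 0

theorem Searchable.congr (hs : Searchable n par s) {s' : State} (harr : s'.arr = s.arr)
    (hreg : ∀ x < 5, x % 2 = 0 → s'.reg x = s.reg x) : Searchable n par s' := by
  obtain ⟨h1, h2, h3, h4, h5⟩ := hs
  constructor <;> simp_all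

theorem Searchable.colorReady (hs : Searchable n par s)
    (hb : ∀ i : Fin c, s.reg (20 + 2 * i) ≤ n) :
    ColorReady n par (fun i : Fin c => s.reg (20 + 2 * i)) s :=
  ⟨hs.reg_n, hs.reg_zero, hs.reg_one, fun _ => rfl, hb, hs.arr_par⟩

theorem Searchable.table_zero (hs : Searchable n par s) (A : Finset (Fin c)) (j : ℕ) :
    s.arr (tableArray A) j = 0 :=
  hs.table _ (Nat.le_add_right _ _) j

/-- Run `colorProgram c` for all values up to `n` of the first `i` degrees. -/
noncomputable def searchProgram (c : ℕ) : ℕ → Program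
  | 0 => colorProgram c
  | i + 1 => .seq (.instr (.const (20 + 2 * i) 0)) (.loop (.le (20 + 2 * i) 0)
      (.seq (searchProgram c i) (.instr (.add (20 + 2 * i) (20 + 2 * i) 4))))

theorem runs_searchProgram (c : ℕ) [NeZero c] (i : ℕ) (hi : i ≤ c) :
    ∃ K, ∀ (n W : ℕ) (par : ℕ → ℕ) (s : State), 0 < n → (∀ k, 0 < k → k < n → par k < k) →
      (c + 2) * (n + 1) ≤ W → Searchable n par s →
      (∀ j : Fin c, i ≤ j → s.reg (20 + 2 * j) ≤ n) →
      Runs W (K * (n + 1) ^ (i + 1)) (searchProgram c i) s (fun s' => s'.arr = s.arr ∧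
        (∀ x, x % 2 = 0 → (∀ j < i, x ≠ 20 + 2 * j) → s'.reg x = s.reg x) ∧
        (s'.reg 3 ≠ 0 ↔ s.reg 3 ≠ 0 ∨ ∃ b : Fin c → ℕ, (∀ j, b j ≤ n) ∧
          (∀ j : Fin c, i ≤ j → b j = s.reg (20 + 2 * j)) ∧ HasColoring n par b)) := by
  induction i with
  | zero =>
    obtain ⟨K, hK⟩ := runs_colorProgram c
    refine ⟨K, fun n W par s hn hpar hW hs hb => ?_⟩
    rw [zero_add, pow_one]
    refine (hK n W par _ s hn hpar hW (hs.colorReady fun j => hb j (Nat.zero_le _))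
      hs.table_zero).mono le_rfl ?_
    rintro s' ⟨h1, h2, h3⟩
    refine ⟨h1, fun x hx _ => h2 x hx, h3.trans (or_congr_right ⟨fun h => ?_, ?_⟩)⟩
    · exact ⟨_, fun j => hb j (Nat.zero_le _), fun j _ => rfl, h⟩
    · rintro ⟨b, -, hbs, h⟩
      obtain rfl : b = _ := funext fun j => hbs j (Nat.zero_le _)
      exact h
  | succ i ih =>
    obtain ⟨K, hK⟩ := ih (by omega)
    refine ⟨K + 4, fun n W par s hn hpar hW hs hb => ?_⟩
    have hWn : n + 1 ≤ W := le_trans (by nlinarith) hW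
    let I : ℕ → State → Prop := fun v s' => s'.arr = s.arr ∧
      (∀ x, x % 2 = 0 → (∀ j < i + 1, x ≠ 20 + 2 * j) → s'.reg x = s.reg x) ∧
      s'.reg (20 + 2 * i) = v ∧
      (s'.reg 3 ≠ 0 ↔ s.reg 3 ≠ 0 ∨ ∃ b : Fin c → ℕ, (∀ j, b j ≤ n) ∧
        (∀ j : Fin c, i + 1 ≤ j → b j = s.reg (20 + 2 * j)) ∧ b ⟨i, hi⟩ < v ∧
          HasColoring n par b)
    have hS : ∀ v s', I v s' → Searchable n par s' := fun v s' hs' =>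
      hs.congr hs'.1 fun x hx hx' => hs'.2.1 x hx' (by intros; omega)
    have hinit : Runs W 1 (.instr (.const (20 + 2 * i) 0)) s (I 0) := by
      refine Runs.of_wp (p := .instr _) ⟨Nat.zero_le _, by simp [Instr.exec], fun x _ hx => ?_,
        by simp [Instr.exec, Instr.value], ?_⟩
      · simp [Instr.exec, hx i (Nat.lt_succ_self i)]
      · have : 3 ≠ 20 + 2 * i := by omega
        simp [Instr.exec, this]
    have hbody : ∀ v < n + 1, ∀ s', I v s' → (Test.le (20 + 2 * i) 0).Holds s' ∧
        Runs W (K * (n + 1) ^ (i + 1) + 1)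
          (.seq (searchProgram c i) (.instr (.add (20 + 2 * i) (20 + 2 * i) 4))) s'
          (I (v + 1)) := by
      intro v hv s₁ hI
      have hs₁ := hS v s₁ hI
      obtain ⟨ha, hr, hrv, h3⟩ := hI
      have hb₁ : ∀ j : Fin c, i + 1 ≤ j → s₁.reg (20 + 2 * j) = s.reg (20 + 2 * j) := fun j hj =>
        hr _ (by omega) (by intros; omega)
      refine ⟨by simp only [Test.Holds, hrv, hs₁.reg_n]; omega, ?_⟩
      refine (hK n W par s₁ hn hpar hW hs₁ fun j hj => ?_).seq fun s₂ hs₂ => ?_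
      · rcases Nat.eq_or_lt_of_le hj with hj | hj
        · rw [← hj, hrv]
          omega
        · rw [hb₁ j hj]
          exact hb j hj
      · obtain ⟨ha₂, hr₂, h3₂⟩ := hs₂
        have e1 : s₂.reg (20 + 2 * i) = v := by
          rw [hr₂ _ (by omega) (by intros; omega), hrv]
        have e2 : s₂.reg 4 = 1 := by
          rw [hr₂ _ (by omega) (by intros; omega), hs₁.reg_one]
        refine Runs.of_wp (p := .instr _) ?_
        simp only [wp, Instr.value, Instr.exec, e1, e2]
        refine ⟨by omega, by simp [ha₂, ha], fun x hx hxj => ?_, by simp, ?_⟩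
        · rw [State.reg_setReg, if_neg (hxj i (Nat.lt_succ_self i)),
            hr₂ x hx fun j hj => hxj j (by omega), hr x hx hxj]
        · rw [State.reg_setReg, if_neg (by omega), h3₂, h3, or_assoc]
          refine or_congr_right ⟨?_, ?_⟩
          · rintro (⟨b, hbn, hbs, hbv, h⟩ | ⟨b, hbn, hbs, h⟩)
            · exact ⟨b, hbn, hbs, by omega, h⟩
            · refine ⟨b, hbn, fun j hj => by rw [hbs j (by omega), hb₁ j hj], ?_, h⟩
              have := hbs ⟨i, hi⟩ le_rfl
              simp only [hrv] at this
              omega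
          · rintro ⟨b, hbn, hbs, hbv, h⟩
            rcases Nat.lt_succ_iff_lt_or_eq.1 hbv with hbv | hbv
            · exact Or.inl ⟨b, hbn, hbs, hbv, h⟩
            · refine Or.inr ⟨b, hbn, fun j hj => ?_, h⟩
              rcases Nat.eq_or_lt_of_le hj with hj | hj
              · obtain rfl : j = ⟨i, hi⟩ := Fin.ext hj.symm
                rw [hbv, hrv]
              · rw [hbs j hj, hb₁ j hj]
    refine (hinit.seq fun s' hs' => Runs.loop hbody (fun s' hs' => ?_) hs').mono ?_ ?_
    · simp only [Test.Holds, hs'.2.2.1, (hS _ _ hs').reg_n]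
      omega
    · have h1 : 1 ≤ (n + 1) ^ (i + 1) := Nat.one_le_pow _ _ (by omega)
      rw [pow_succ (n + 1) (i + 1)]
      generalize (n + 1) ^ (i + 1) = y at h1
      nlinarith
    · rintro s' ⟨ha, hr, -, h3⟩
      refine ⟨ha, hr, h3.trans (or_congr_right ⟨?_, ?_⟩)⟩
      · rintro ⟨b, hbn, hbs, -, h⟩
        exact ⟨b, hbn, hbs, h⟩
      · rintro ⟨b, hbn, hbs, h⟩
        exact ⟨b, hbn, hbs, Nat.lt_succ_of_le (hbn _), h⟩

/-- Set register `3` to a nonzero number if and only if there is a colouring with `c` colours. -/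
noncomputable def searchAllProgram (c : ℕ) : Program :=
  .seq (.instr (.const 3 0)) (searchProgram c c)

theorem runs_searchAllProgram (c : ℕ) [NeZero c] :
    ∃ K, ∀ (n W : ℕ) (par : ℕ → ℕ) (s : State), 0 < n → (∀ k, 0 < k → k < n → par k < k) →
      (c + 2) * (n + 1) ≤ W → Searchable n par s →
      Runs W (K * (n + 1) ^ (c + 1)) (searchAllProgram c) s (fun s' => s'.arr = s.arr ∧
        (∀ x < 20, x % 2 = 0 → s'.reg x = s.reg x) ∧
        (s'.reg 3 ≠ 0 ↔ ∃ b : Fin c → ℕ, HasColoring n par b)) := by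
  obtain ⟨K, hK⟩ := runs_searchProgram c c le_rfl
  refine ⟨K + 1, fun n W par s hn hpar hW hs => ?_⟩
  have hinit : Runs W 1 (.instr (.const 3 0)) s (fun s' => s' = s.setReg 3 0) :=
    Runs.of_wp (p := .instr _) ⟨Nat.zero_le _, rfl⟩
  have hsearch := hK n W par (s.setReg 3 0) hn hpar hW
    (hs.congr (by simp) fun x _ hx => by
      have : x ≠ 3 := by omega
      simp [this])
    (fun j hj => by omega)
  refine (hinit.seq fun s' hs' => by subst hs'; exact hsearch).mono ?_ ?_
  · have h1 : 1 ≤ (n + 1) ^ (c + 1) := Nat.one_le_pow _ _ (by omega)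
    rw [Nat.add_mul]
    omega
  · rintro s' ⟨ha, hr, h3⟩
    refine ⟨ha, fun x hx hx' => ?_, ?_⟩
    · have h3 : x ≠ 3 := by omega
      rw [hr x hx' (by intros; omega), State.reg_setReg, if_neg h3]
    · rw [h3]
      simp only [State.reg_setReg, if_true, ne_eq, not_true_eq_false, false_or]
      constructor
      · rintro ⟨b, -, -, h⟩
        exact ⟨b, h⟩
      · rintro ⟨b, h⟩
        obtain ⟨b, hbn, h⟩ := h.exists_le hn
        exact ⟨b, hbn, fun j hj => by omega, h⟩

/-! ### The maximum degree -/

/-- Increase the entry of array `4` for the vertex in register `x`, and update the maximum in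
register `6`. -/
def bumpProgram (x : ℕ) : Program :=
  seqs [.instr (.load 5 4 x), .instr (.add 5 5 4), .instr (.store 4 x 5),
    .ite (.lt 6 5) (.instr (.copy 6 5)) .skip]

/-- `D` is the maximum of `f`, attained at a number less than `n`. -/
def IsMaxBelow (n : ℕ) (f : ℕ → ℕ) (D : ℕ) : Prop :=
  (∀ j, f j ≤ D) ∧ ∃ j < n, f j = D

theorem wp_bump {x v : ℕ} {f : ℕ → ℕ} (hx : x ≠ 5) (h1 : s.reg 4 = 1) (hv : s.reg x = v)
    (hf : s.arr 4 = f) (hmax : IsMaxBelow n f (s.reg 6)) (hvn : v < n) (hW : f v + 1 ≤ W) :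
    wp W (bumpProgram x) (fun s' => s'.arr 4 = Function.update f v (f v + 1) ∧
      IsMaxBelow n (s'.arr 4) (s'.reg 6) ∧ (∀ a, a ≠ 4 → s'.arr a = s.arr a) ∧
      ∀ y, y ≠ 5 → y ≠ 6 → s'.reg y = s.reg y) s := by
  obtain ⟨hle, j, hj, hjD⟩ := hmax
  have harr : ((((s.setReg 5 (f v)).setReg 5 (f v + 1)).setArr 4 v (f v + 1))).arr 4 =
      Function.update f v (f v + 1) := by
    simp [State.setArr, State.setReg, hf]
  have harr' : ∀ a, a ≠ 4 →
      ((((s.setReg 5 (f v)).setReg 5 (f v + 1)).setArr 4 v (f v + 1))).arr a = s.arr a := by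
    intro a ha
    simp [State.setArr, State.setReg, ha]
  simp only [bumpProgram, seqs, wp, Instr.value, Instr.exec, State.reg_setReg, State.reg_setArr,
    State.arr_setReg, Nat.reduceEqDiff, if_true, if_false, hv, hf, h1, hx, Test.Holds, harr]
  refine ⟨by omega, hW, hW, fun hlt => ⟨hW, trivial, ⟨fun i => ?_, v, hvn, by simp⟩, harr',
    fun y h5 h6 => by simp [h5, h6]⟩, fun hlt => ⟨trivial, ⟨fun i => ?_, ?_⟩, harr',
    fun y h5 h6 => by simp [h5]⟩⟩
  · by_cases hi : i = v
    · simp [hi]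
    · rw [Function.update_of_ne hi]
      exact (hle i).trans hlt.le
  · by_cases hi : i = v
    · subst hi
      simp only [Function.update_self, not_lt] at hlt ⊢
      exact hlt
    · rw [Function.update_of_ne hi]
      exact hle i
  · refine ⟨j, hj, ?_⟩
    rw [Function.update_of_ne, hjD]
    rintro rfl
    omega

/-- Compute the degrees in array `4` and the maximum degree in register `6`. -/
def degreeProgram : Program :=
  seqs [.instr (.const 6 0), .instr (.copy 1 4),
    .loop (.lt 1 0) (seqs [bumpProgram 1, .instr (.load 7 3 1), bumpProgram 7,
      .instr (.add 1 1 4)])]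

/-- The degrees in the subtree on the vertices `0, …, k - 1`. -/
def partialDegree (par : ℕ → ℕ) (k j : ℕ) : ℕ :=
  #{l ∈ Ico 1 k | par l = j} + if 0 < j ∧ j < k then 1 else 0

theorem partialDegree_le (k j : ℕ) : partialDegree par k j ≤ k := by
  have : #{l ∈ Ico 1 k | par l = j} ≤ k - 1 := (card_filter_le _ _).trans (by simp)
  unfold partialDegree
  split_ifs <;> omega

theorem partialDegree_succ {k : ℕ} (hk : 0 < k) (hpar : par k < k) :
    partialDegree par (k + 1) =
      Function.update (Function.update (partialDegree par k) k (partialDegree par k k + 1)) (par k)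
        (partialDegree par k (par k) + 1) := by
  ext j
  have h1 : #{l ∈ Ico 1 (k + 1) | par l = j} =
      #{l ∈ Ico 1 k | par l = j} + if par k = j then 1 else 0 := by
    rw [← Finset.insert_Ico_right_eq_Ico_add_one hk, filter_insert]
    split_ifs
    · rw [card_insert_of_notMem (by simp)]
    · rfl
  by_cases hjp : j = par k
  · subst hjp
    rw [Function.update_self]
    have h2 : (0 < par k ∧ par k < k + 1) ↔ 0 < par k ∧ par k < k := by omega
    simp only [partialDegree, h1, h2, if_true]
    omega
  · rw [Function.update_of_ne hjp]
    by_cases hjk : j = k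
    · subst hjk
      simp [partialDegree, h1, hk, hpar.ne]
    · have h2 : (0 < j ∧ j < k + 1) ↔ 0 < j ∧ j < k := by omega
      simp only [partialDegree, h1, h2, Ne.symm hjp, hjk, if_false, add_zero, ne_eq,
        not_false_eq_true, Function.update_of_ne]

theorem runs_degreeProgram : ∃ K, ∀ (n W : ℕ) (par : ℕ → ℕ) (s : State), 0 < n →
    (∀ k, 0 < k → k < n → par k < k) → n + 1 ≤ W → Searchable n par s → (∀ j, s.arr 4 j = 0) →
    Runs W (K * (n + 1)) degreeProgram s (fun s' => Searchable n par s' ∧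
      (∀ j < n, treeDegree n par j ≤ s'.reg 6) ∧ ∃ j < n, treeDegree n par j = s'.reg 6) := by
  let body : Program := seqs [bumpProgram 1, .instr (.load 7 3 1), bumpProgram 7,
    .instr (.add 1 1 4)]
  refine ⟨body.cost + 4, fun n W par s hn hpar hW hs h4 => ?_⟩
  let I : ℕ → State → Prop := fun i s' => Searchable n par s' ∧ s'.reg 1 = i + 1 ∧
    s'.arr 4 = partialDegree par (i + 1) ∧ IsMaxBelow n (s'.arr 4) (s'.reg 6)
  have h1 : Runs W 1 (.instr (.const 6 0)) s (fun s' => s' = s.setReg 6 0) :=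
    Runs.of_wp (p := .instr _) ⟨Nat.zero_le _, rfl⟩
  have h2 : ∀ s', s' = s.setReg 6 0 → Runs W 1 (.instr (.copy 1 4)) s' (I 0) := by
    rintro s' rfl
    refine Runs.of_wp (p := .instr _) ?_
    simp only [wp, Instr.value, Instr.exec, State.reg_setReg, Nat.reduceEqDiff, if_false,
      hs.reg_one]
    have hp : s.arr 4 = partialDegree par 1 := by
      ext j
      have : ¬ (0 < j ∧ j < 1) := by omega
      rw [h4, partialDegree, if_neg this]
      simp
    refine ⟨by omega, hs.congr (by simp) fun x hx hx' => ?_, by simp, by simpa using hp,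
      fun j => by simp [h4], 0, hn, by simp [h4]⟩
    have h6 : x ≠ 6 := by omega
    have h1 : x ≠ 1 := by omega
    simp [h6, h1]
  have h3 : ∀ s', I 0 s' → Runs W ((n - 1) * (body.cost + 1) + 1) (.loop (.lt 1 0) body) s'
      (I (n - 1)) := by
    intro s' hs'
    refine Runs.loop (fun i hi s' hs' => ⟨?_, Runs.of_wp ?_⟩) (fun s' hs' => ?_) hs'
    · simp only [Test.Holds, hs'.1.reg_n, hs'.2.1]
      omega
    · obtain ⟨hS, hr1, harr, hmax⟩ := hs'
      have hp := hpar (i + 1) (Nat.succ_pos i) (by omega)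
      have hd := partialDegree_le (par := par) (i + 1)
      refine wp_mono (p := bumpProgram 1) ?_ (wp_bump (by norm_num) hS.reg_one hr1 harr
        (harr ▸ hmax) (by omega) (by have := hd (i + 1); omega))
      rintro s₁ ⟨harr₁, hmax₁, ha₁, hr₁⟩
      have e4 : s₁.reg 4 = 1 := by rw [hr₁ 4 (by omega) (by omega), hS.reg_one]
      have e1 : s₁.reg 1 = i + 1 := by rw [hr₁ 1 (by omega) (by omega), hr1]
      have epar : s₁.arr 3 (i + 1) = par (i + 1) := by
        rw [ha₁ 3 (by omega), hS.arr_par _ (Nat.succ_pos i) (by omega)]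
      simp only [seqs, wp, Instr.value, Instr.exec, e1, epar]
      refine ⟨by omega, ?_⟩
      have hne : par (i + 1) ≠ i + 1 := hp.ne
      refine wp_mono (p := bumpProgram 7) ?_ (wp_bump (v := par (i + 1)) (by norm_num)
        (by simpa using e4) (by simp) (by simpa using harr₁) (by simpa [harr₁] using hmax₁)
        (by omega) (by rw [Function.update_of_ne hne]; have := hd (par (i + 1)); omega))
      rintro s₂ ⟨harr₂, hmax₂, ha₂, hr₂⟩
      rw [Function.update_of_ne hne, ← partialDegree_succ (Nat.succ_pos i) hp] at harr₂
      have er : ∀ x, x ≠ 5 → x ≠ 6 → x ≠ 7 → s₂.reg x = s'.reg x := by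
        intro x h5 h6 h7
        rw [hr₂ x h5 h6, State.reg_setReg, if_neg h7, hr₁ x h5 h6]
      have ea : ∀ a, a ≠ 4 → s₂.arr a = s'.arr a := by
        intro a h4
        rw [ha₂ a h4, State.arr_setReg, ha₁ a h4]
      simp only [er 1 (by omega) (by omega) (by omega), er 4 (by omega) (by omega) (by omega), hr1,
        hS.reg_one]
      refine ⟨by omega, ⟨?_, ?_, ?_, fun k hk hkn => ?_, fun a ha j => ?_⟩, by simp,
        by simpa using harr₂, by simpa using hmax₂⟩
      · simpa [er] using hS.reg_n
      · simpa [er] using hS.reg_zero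
      · simpa [er] using hS.reg_one
      · simpa [ea] using hS.arr_par k hk hkn
      · rw [State.arr_setReg, ea a (by omega), hS.table a ha]
    · simp only [Test.Holds, hs'.1.reg_n, hs'.2.1]
      omega
  refine (h1.seq fun s' hs' => (h2 s' hs').seq fun s' hs' =>
    (h3 s' hs').seq fun s' hs' => Runs.of_wp (p := .skip) hs').mono ?_ ?_
  · obtain ⟨k, rfl⟩ : ∃ k, n = k + 1 := ⟨n - 1, by omega⟩
    simp only [Nat.add_sub_cancel, Program.cost]
    nlinarith
  · rintro s' ⟨hS, -, harr, hle, j, hj, hjD⟩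
    rw [Nat.sub_add_cancel hn] at harr
    have htree : ∀ j < n, s'.arr 4 j = treeDegree n par j := by
      intro j hj
      simp [harr, partialDegree, treeDegree, hj]
    exact ⟨hS, fun j hj => by rw [← htree j hj]; exact hle j, j, hj, by rw [← htree j hj, hjD]⟩

end RAM

/-! ### The algorithms -/

namespace RAM

open SimpleGraph Finset

variable {n : ℕ} {T : SimpleGraph (Fin n)} {l : List (Fin n × Fin n)} {e : ℕ → Fin n}
  {par : ℕ → ℕ} {s : State}

theorem Growing.searchable (h : Growing T l n e par s) : Searchable n par s :=
  ⟨h.reg_n, h.reg_zero, h.reg_one, h.arr_par, fun a ha => h.arr_zero a (by omega)⟩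

theorem decidableOnTreesInTime_of_runs {P : ∀ n : ℕ, SimpleGraph (Fin n) → Prop} {k w K : ℕ}
    (p : Program) (hp : ∀ (n W : ℕ) (T : SimpleGraph (Fin n)) (l : List (Fin n × Fin n)),
      T.IsTree → IsEdgeList T l → 0 < n → w * (n + 1) ≤ W →
        Runs W (K * (n + 1) ^ k) p (input n l) fun s => s.reg 0 ≠ 0 ↔ P n T) :
    DecidableOnTreesInTime P k := by
  refine ⟨p, K * 2 ^ k + 2 * w, 1, fun n T hT l hl => ?_⟩
  have hn : 1 ≤ n := by
    have := hl.length_add_one hT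
    omega
  obtain ⟨t, s, he, ht, hs⟩ := hp n ((K * 2 ^ k + 2 * w) * n ^ 1) T l hT hl hn (by
    calc w * (n + 1) ≤ w * (2 * n) := Nat.mul_le_mul_left _ (by omega)
      _ ≤ (K * 2 ^ k + 2 * w) * n ^ 1 := by
        rw [pow_one, Nat.add_mul]
        calc w * (2 * n) = 2 * w * n := by ring
          _ ≤ _ := Nat.le_add_left _ _)
  refine ⟨t, s, he, ht.trans ?_, hs⟩
  calc K * (n + 1) ^ k ≤ K * (2 * n) ^ k :=
        Nat.mul_le_mul_left _ (Nat.pow_le_pow_left (by omega) _)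
    _ = K * 2 ^ k * n ^ k := by rw [mul_pow, mul_assoc]
    _ ≤ (K * 2 ^ k + 2 * w) * n ^ k := Nat.mul_le_mul_right _ (Nat.le_add_right _ _)

/-- Set register `0` to `1` if register `3` is nonzero, and to `0` otherwise. -/
def answerProgram : Program :=
  seqs [.instr (.const 0 0), .ite (.ne 3 2) (.instr (.const 0 1)) .skip]

theorem decidable_wr_le (c : ℕ) [NeZero c] :
    DecidableOnTreesInTime (fun _ T => T.wr ≤ c) (c + 1) := by
  obtain ⟨K₁, h₁⟩ := runs_growProgram
  obtain ⟨K₂, h₂⟩ := runs_searchAllProgram c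
  have hc : 0 < c := NeZero.pos c
  refine decidableOnTreesInTime_of_runs (w := c + 2) (K := K₁ + (K₂ + answerProgram.cost))
    (.seq growProgram (.seq (searchAllProgram c) answerProgram)) fun n W T l hT hl hn hW => ?_
  have hWn : n + 1 ≤ W := le_trans (by nlinarith) hW
  refine ((h₁ n W T l hT hl hWn).seq fun s ⟨e, par, hG⟩ =>
    ((h₂ n W par s hn hG.growth.lt hW hG.searchable).mono (Q := fun s' => s'.reg 2 = 0 ∧
      (s'.reg 3 ≠ 0 ↔ T.wr ≤ c)) le_rfl ?_).seq fun s' hs' => Runs.of_wp ?_).mono ?_ fun _ h => h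
  · rintro s' ⟨-, hr, h3⟩
    rw [h3, hG.growth.wr_le_iff hT (by simp) hc, hr 2 (by norm_num) (by norm_num)]
    exact ⟨hG.reg_zero, Iff.rfl⟩
  · simp only [answerProgram, seqs, wp, Instr.value, Instr.exec, Test.Holds, State.reg_setReg,
      Nat.reduceEqDiff, if_true, if_false, hs'.1, hs'.2]
    exact ⟨Nat.zero_le _, fun h => ⟨by omega, by simpa using h⟩, fun h => by simpa using h⟩
  · have h1 : (n + 1) ^ 2 ≤ (n + 1) ^ (c + 1) := Nat.pow_le_pow_right (by omega) (by omega)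
    have h2 : 1 ≤ (n + 1) ^ (c + 1) := Nat.one_le_pow _ _ (by omega)
    generalize (n + 1) ^ (c + 1) = y at h1 h2
    nlinarith [Nat.mul_le_mul_left K₁ h1, Nat.mul_le_mul_left answerProgram.cost h2]

theorem decidable_wr_le_zero : DecidableOnTreesInTime (fun _ T => T.wr ≤ 0) 0 := by
  let p : Program := seqs [.instr (.const 1 1), .ite (.eq 0 1) .skip (.instr (.const 0 0))]
  refine decidableOnTreesInTime_of_runs (w := 1) (K := p.cost) p fun n W T l hT hl hn hW => ?_
  classical
  have hwr : T.wr ≤ 0 ↔ n = 1 := by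
    have h1 := hT.card_edgeFinset
    rw [Fintype.card_fin] at h1
    rw [Nat.le_zero, wr_eq_zero_iff, ← edgeFinset_eq_empty, ← card_eq_zero]
    omega
  rw [pow_zero, mul_one, hwr]
  refine Runs.of_wp ?_
  have h0 : (input n l).reg 0 = n := rfl
  simp only [p, seqs, wp, Instr.value, Instr.exec, Test.Holds, State.reg_setReg, Nat.reduceEqDiff,
    if_true, if_false, h0]
  refine ⟨by omega, fun h => ?_, fun h => ⟨by omega, ?_⟩⟩
  · simp [h]
  · simp [h]

/-- Set register `3` to a nonzero number if and only if there is a colouring with two colours,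
trying the pairs of degrees that the maximum degree in register `6` permits. -/
noncomputable def pairProgram : Program :=
  seqs [.instr (.const 3 0), .instr (.const 20 0),
    .loop (.le 20 0) (seqs [.instr (.copy 22 6), colorProgram 2, .instr (.sub 22 6 4),
      colorProgram 2, .instr (.sub 22 6 20), colorProgram 2, .instr (.add 20 20 4)])]

theorem runs_pairProgram : ∃ K, ∀ (n W : ℕ) (par : ℕ → ℕ) (s : State), 0 < n →
    (∀ k, 0 < k → k < n → par k < k) → 4 * (n + 1) ≤ W → Searchable n par s →
    (∀ j < n, treeDegree n par j ≤ s.reg 6) → (∃ j < n, treeDegree n par j = s.reg 6) →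
    Runs W (K * (n + 1) ^ 2) pairProgram s (fun s' => Searchable n par s' ∧
      (s'.reg 3 ≠ 0 ↔ ∃ b : Fin 2 → ℕ, HasColoring n par b)) := by
  obtain ⟨K, hK⟩ := runs_colorProgram 2
  refine ⟨3 * K + 20, fun n W par s hn hpar hW hs hD hD' => ?_⟩
  have hDn : s.reg 6 ≤ n := by
    obtain ⟨j, -, hj⟩ := hD'
    rw [← hj]
    exact treeDegree_le hn
  obtain ⟨D, hDs⟩ : ∃ D, s.reg 6 = D := ⟨_, rfl⟩
  rw [hDs] at hD hD' hDn
  -- The state between calls of `colorProgram`; `φ` says whether one of them has succeeded.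
  let J : ℕ → Prop → State → Prop := fun v φ s' => Searchable n par s' ∧ s'.reg 6 = D ∧
    s'.reg 20 = v ∧ (s'.reg 3 ≠ 0 ↔ φ)
  -- One call of `colorProgram`, after the second degree `y` has been computed.
  have hcolor : ∀ (i : Instr) (y v : ℕ) (φ : Prop) (s : State), v ≤ n → y ≤ n → J v φ s →
      i.value s = y → i.exec s = s.setReg 22 y → ∀ (q : Program) (t : ℕ) (Q : State → Prop),
        (∀ s', J v (φ ∨ HasColoring n par ![v, y]) s' → Runs W t q s' Q) →
          Runs W (1 + (K * (n + 1) + t)) (.seq (.instr i) (.seq (colorProgram 2) q)) s Q := by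
    intro i y v φ s hv hy ⟨hs, h6, h20, h3⟩ hval hexec q t Q hq
    refine Runs.seq (P := fun s' => s' = s.setReg 22 y)
      (Runs.of_wp (p := .instr i) ⟨by rw [hval]; omega, hexec⟩) ?_
    rintro s' rfl
    have hs' : Searchable n par (s.setReg 22 y) := hs.congr (by simp) fun x hx _ => by
      have : x ≠ 22 := by omega
      simp [this]
    have hb : (fun i : Fin 2 => (s.setReg 22 y).reg (20 + 2 * i)) = ![v, y] := by
      ext i
      fin_cases i
      · simp [h20]
      · simp
    have hready := hs'.colorReady (c := 2) (fun i => by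
      rw [show (s.setReg 22 y).reg (20 + 2 * i) = ![v, y] i from congrFun hb i]
      fin_cases i
      · exact hv
      · exact hy)
    rw [hb] at hready
    refine (hK n W par _ _ hn hpar hW hready hs'.table_zero).seq fun s' hs'' => hq s' ?_
    obtain ⟨ha, hr, h3'⟩ := hs''
    refine ⟨hs'.congr ha fun x _ hx => hr x hx, ?_, ?_, ?_⟩
    · rw [hr 6 (by omega)]
      simpa using h6
    · rw [hr 20 (by omega)]
      simpa using h20
    · rw [h3', ← h3]
      simp
  let Φ : ℕ → Prop := fun v => ∃ x < v, HasColoring n par ![x, D] ∨ HasColoring n par ![x, D - 1] ∨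
    HasColoring n par ![x, D - x]
  have hbody : ∀ v < n + 1, ∀ s, J v (Φ v) s → (Test.le 20 0).Holds s ∧
      Runs W (3 * K * (n + 1) + 4) (seqs [.instr (.copy 22 6), colorProgram 2,
        .instr (.sub 22 6 4), colorProgram 2, .instr (.sub 22 6 20), colorProgram 2,
        .instr (.add 20 20 4)]) s (J (v + 1) (Φ (v + 1))) := by
    intro v hv s hs
    refine ⟨by simp only [Test.Holds, hs.2.2.1, hs.1.reg_n]; omega, ?_⟩
    refine (hcolor (.copy 22 6) D v _ s (by omega) hDn hs hs.2.1
      (by simp [Instr.exec, Instr.value, hs.2.1]) _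
      (1 + (K * (n + 1) + (1 + (K * (n + 1) + 1)))) _ fun s₁ hs₁ => ?_).mono
      (by nlinarith) fun _ h => h
    refine hcolor (.sub 22 6 4) (D - 1) v _ s₁ (by omega) (by omega) hs₁
      (by simp [Instr.value, hs₁.2.1, hs₁.1.reg_one])
      (by simp [Instr.exec, Instr.value, hs₁.2.1, hs₁.1.reg_one]) _ _ _ fun s₂ hs₂ => ?_
    refine hcolor (.sub 22 6 20) (D - v) v _ s₂ (by omega) (by omega) hs₂
      (by simp [Instr.value, hs₂.2.1, hs₂.2.2.1])
      (by simp [Instr.exec, Instr.value, hs₂.2.1, hs₂.2.2.1]) _ _ _ fun s₃ hs₃ => ?_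
    refine Runs.of_wp (p := .seq (.instr _) .skip) ?_
    simp only [wp, Instr.value, Instr.exec, hs₃.2.2.1, hs₃.1.reg_one]
    refine ⟨by omega, hs₃.1.congr (by simp) fun x hx _ => ?_, by simpa using hs₃.2.1, by simp, ?_⟩
    · have : x ≠ 20 := by omega
      simp [this]
    · simp only [State.reg_setReg, Nat.reduceEqDiff, if_false, hs₃.2.2.2]
      simp only [Φ, Nat.lt_succ_iff_lt_or_eq, or_and_right, exists_or, exists_eq_left, or_assoc]
  have hinit₁ : Runs W 1 (.instr (.const 3 0)) s (fun s' => s' = s.setReg 3 0) :=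
    Runs.of_wp (p := .instr _) ⟨Nat.zero_le _, rfl⟩
  have hinit₂ : ∀ s', s' = s.setReg 3 0 → Runs W 1 (.instr (.const 20 0)) s' (J 0 (Φ 0)) := by
    rintro s' rfl
    refine Runs.of_wp (p := .instr _) ⟨Nat.zero_le _, hs.congr (by simp [Instr.exec])
      fun x hx hx' => ?_, ?_, ?_, ?_⟩
    · have h3 : x ≠ 3 := by omega
      have h20 : x ≠ 20 := by omega
      simp [Instr.exec, h3, h20]
    · simpa [Instr.exec] using hDs
    · simp [Instr.exec, Instr.value]
    · simp [Instr.exec, Φ]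
  refine (hinit₁.seq fun s' hs' => (hinit₂ s' hs').seq fun s' hs' =>
    (Runs.loop hbody (fun s' hs' => ?_) hs').seq fun s' hs' =>
      Runs.of_wp (p := .skip) hs').mono ?_ ?_
  · simp only [Test.Holds, hs'.2.2.1, hs'.1.reg_n]
    omega
  · simp only [Program.cost]
    nlinarith
  · rintro s' ⟨hs', -, -, h3⟩
    refine ⟨hs', h3.trans ⟨?_, ?_⟩⟩
    · rintro ⟨x, -, h | h | h⟩ <;> exact ⟨_, h⟩
    · rintro ⟨b, h⟩
      obtain ⟨x, hx, h⟩ := h.exists_candidate hn hD hD'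
      exact ⟨x, Nat.lt_succ_of_le hx, h⟩

/-- Decide whether two colours suffice but one does not; register `8` keeps the result for two
colours during the search with one colour. -/
noncomputable def twoProgram : Program :=
  .seq growProgram (.seq degreeProgram (.seq pairProgram (.seq
    (seqs [.instr (.const 8 0), .ite (.ne 3 2) (.instr (.const 8 1)) .skip])
    (.seq (searchAllProgram 1)
      (seqs [.instr (.const 0 0),
        .ite (.eq 3 2) (.ite (.ne 8 2) (.instr (.const 0 1)) .skip) .skip])))))

theorem decidable_wr_eq_two : DecidableOnTreesInTime (fun _ T => T.wr = 2) 2 := by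
  obtain ⟨K₁, h₁⟩ := runs_growProgram
  obtain ⟨K₂, h₂⟩ := runs_degreeProgram
  obtain ⟨K₃, h₃⟩ := runs_pairProgram
  obtain ⟨K₄, h₄⟩ := runs_searchAllProgram 1
  let save : Program := seqs [.instr (.const 8 0), .ite (.ne 3 2) (.instr (.const 8 1)) .skip]
  let answer : Program := seqs [.instr (.const 0 0),
    .ite (.eq 3 2) (.ite (.ne 8 2) (.instr (.const 0 1)) .skip) .skip]
  refine decidableOnTreesInTime_of_runs (w := 4)
    (K := K₁ + (K₂ + (K₃ + (save.cost + (K₄ + answer.cost))))) twoProgram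
    fun n W T l hT hl hn hW => ?_
  have hWn : n + 1 ≤ W := by omega
  refine ((h₁ n W T l hT hl hWn).seq fun s ⟨e, par, hG⟩ =>
    (h₂ n W par s hn hG.growth.lt hWn hG.searchable (hG.arr_zero 4 le_rfl)).seq
      fun s₁ ⟨hs₁, hD, hD'⟩ => (h₃ n W par s₁ hn hG.growth.lt hW hs₁ hD hD').seq
        fun s₂ ⟨hs₂, h3⟩ => (Runs.of_wp (p := save) (Q := fun s' => Searchable n par s' ∧
          (s'.reg 8 ≠ 0 ↔ T.wr ≤ 2)) ?_).seq
          fun s₃ ⟨hs₃, h8⟩ => ((h₄ n W par s₃ hn hG.growth.lt (by omega) hs₃).mono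
            (Q := fun s' => s'.reg 2 = 0 ∧ (s'.reg 8 ≠ 0 ↔ T.wr ≤ 2) ∧
              (s'.reg 3 ≠ 0 ↔ T.wr ≤ 1)) le_rfl ?_).seq
              fun s₄ hs₄ => Runs.of_wp (p := answer) ?_).mono ?_ fun _ h => h
  · rw [← hG.growth.wr_le_iff hT (by simp) two_pos] at h3
    simp only [save, seqs, wp, Instr.value, Instr.exec, Test.Holds, State.reg_setReg,
      Nat.reduceEqDiff, if_false, hs₂.reg_zero, h3]
    have hset : ∀ v, Searchable n par (s₂.setReg 8 v) := fun v =>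
      hs₂.congr (by simp) fun x hx _ => by
        have : x ≠ 8 := by omega
        simp [this]
    refine ⟨Nat.zero_le _, fun h => ⟨by omega, (hset 0).congr (by simp) fun x hx _ => ?_,
      by simpa using h⟩, fun h => ⟨hset 0, by simpa using h⟩⟩
    have : x ≠ 8 := by omega
    simp [this]
  · rintro s' ⟨-, hr, h3⟩
    rw [h3, hG.growth.wr_le_iff hT (by simp) one_pos, hr 2 (by norm_num) (by norm_num),
      hr 8 (by norm_num) (by norm_num)]
    exact ⟨hs₃.reg_zero, h8, Iff.rfl⟩
  · obtain ⟨h2, h8, h3⟩ := hs₄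
    rw [← not_iff_not, not_not] at h3
    have hwr : T.wr = 2 ↔ T.wr ≤ 2 ∧ ¬ T.wr ≤ 1 := by omega
    simp only [answer, seqs, wp, Instr.value, Instr.exec, Test.Holds, State.reg_setReg,
      Nat.reduceEqDiff, if_true, if_false, h2, h3, h8, hwr]
    exact ⟨Nat.zero_le _, fun h => ⟨fun h' => ⟨by omega, by simp [h, h']⟩, fun h' => by simp [h']⟩,
      fun h => by simp at h; simp [h]⟩
  · have e1 : n + 1 ≤ (n + 1) ^ 2 := Nat.le_self_pow (by norm_num) _
    have e2 : 1 ≤ (n + 1) ^ 2 := Nat.one_le_pow _ _ (by omega)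
    change _ + (_ + (_ + (_ + (_ * (n + 1) ^ 2 + _)))) ≤ _
    generalize (n + 1) ^ 2 = y at e1 e2
    nlinarith [Nat.mul_le_mul_left K₂ e1, Nat.mul_le_mul_left save.cost e2,
      Nat.mul_le_mul_left answer.cost e2]

end RAM

theorem theorem1 :
    RAM.DecidableOnTreesInTime (fun _ T => T.wr = 2) 2 ∧
    (∀ c : ℕ, ∃ k : ℕ, RAM.DecidableOnTreesInTime (fun _ T => T.wr ≤ c) k) ∧
    (∃ C : ℝ, ∀ (V : Type*) [Fintype V] (T : SimpleGraph V) [DecidableRel T.Adj], T.IsTree →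
      (T.wr : ℝ) ≤ 2 * Real.logb 2 (T.maxDegree : ℝ) + C) := by
  refine ⟨RAM.decidable_wr_eq_two, fun c => ?_, 2, fun V _ T _ hT => hT.wr_le_two_mul_logb T⟩
  rcases Nat.eq_zero_or_pos c with rfl | hc
  · exact ⟨0, RAM.decidable_wr_le_zero⟩
  · have : NeZero c := ⟨hc.ne'⟩
    exact ⟨c + 1, RAM.decidable_wr_le c⟩
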